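/- Let $M$ be a smooth (Hausdorff, second countable) manifold and let $(A,a,[\cdot,\cdot])$ be a Lie algebroid over $M$ of rank $n$, i.e. $A\to M$ is a smooth real vector bundle of rank $n$, $[\cdot,\cdot]$ is a Lie bracket on $\Gamma(A)$, and the anchor $a:A\to TM$ is a smooth bundle map, compatible with brackets, with $[X,fY]=f[X,Y]+(a(X)f)Y$. Let $\mathcal A=\bigoplus_{k}\Gamma(\wedge^kA)$, with the wedge product and the Schouten bracket: the extension of $[X,Y]$, $[X,f]=a(X)f$, $[f,g]=0$ ($X,Y\in\Gamma(A)$, $f,g\in C^\infty(M)$) to $\mathcal A$ that satisfies, for homogeneous elements of degrees $|P|,|Q|$, $$[P,Q]=-(-1)^{(|P|-1)(|Q|-1)}[Q,P],\qquad [P,Q\wedge R]=[P,Q]\wedge R+(-1)^{(|P|-1)|Q|}\,Q\wedge[P,R].$$ Write $L_XP=[X,P]$ for $X\in\Gamma(A)$, $P\in\mathcal A$. An $A$-connection on the line bundle $\wedge^nA$ is an $\mathbb R$-bilinear map $\nabla:\Gamma(A)\times\Gamma(\wedge^nA)\to\Gamma(\wedge^nA)$ with $\nabla_{fX}\Lambda=f\nabla_X\Lambda$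 and $\nabla_X(f\Lambda)=(a(X)f)\Lambda+f\nabla_X\Lambda$; it is flat if $\nabla_X\nabla_Y-\nabla_Y\nabla_X-\nabla_{[X,Y]}=0$ for all $X,Y\in\Gamma(A)$. A Gerstenhaber generator is an $\mathbb R$-linear operator $\widetilde D:\mathcal A\to\mathcal A$ of degree $-1$ with $$[P,Q]=(-1)^{|P|}\big(\widetilde D(P\wedge Q)-\widetilde DP\wedge Q-(-1)^{|P|}P\wedge\widetilde DQ\big)$$ for all homogeneous $P\in\mathcal A$ and all $Q\in\mathcal A$; it is a BV-generator if moreover $\widetilde D^2=0$. Then there is a bijection $\nabla\mapsto\widetilde D$ from the set of $A$-connections on $\wedge^nA$ onto the set of Gerstenhaber generators such that, for corresponding $\nabla$ and $\widetilde D$ and all $X\in\Gamma(A)$, $\Lambda\in\Gamma(\wedge^nA)$, $$(\widetilde DX)\,\Lambda=L_X\Lambda-\nabla_X\Lambda\qquad\text{and}\qquad \nabla_X\Lambda=-X\wedge\widetilde D\Lambda .$$ Under this bijection, $\nabla$ is flat if and only if $\widetilde D$ is a BV-generator. -/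

import Mathlib

open Bundle
open scoped Manifold ContDiff Topology

noncomputable section

namespace AlgebroidBV

section Multisections

variable {E : Type*} [NormedAddCommGroup E] [NormedSpace ℝ E]
  {M : Type*} [TopologicalSpace M] [ChartedSpace E M]
  {F : Type*} [NormedAddCommGroup F] [NormedSpace ℝ F]
  {A : M → Type*} [TopologicalSpace (TotalSpace F A)] [∀ x, TopologicalSpace (A x)]
  [∀ x, AddCommGroup (A x)] [∀ x, Module ℝ (A x)] [FiberBundle F A] [VectorBundle ℝ F A]

/-- The product `f • X` of a smooth function and a smooth section of a vector bundle. -/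
instance : SMul C^∞⟮𝓘(ℝ, E), M; 𝓘(ℝ, ℝ), ℝ⟯ Cₛ^∞⟮𝓘(ℝ, E); F, A⟯ :=
  ⟨fun f X => ⟨fun x => f x • X x, f.contMDiff.smul_section X.contMDiff⟩⟩

variable (F) in
/-- The expression, in the preferred local trivialization of `A` around `x₀`, of a family
`P x ∈ ⋀ (A x)`: a function on `M` with values in the fixed vector space `⋀ F`, relevant over the
base set of the trivialization. -/
def localRep (x₀ : M) (P : ∀ x, ExteriorAlgebra ℝ (A x)) (x : M) : ExteriorAlgebra ℝ F :=
  ExteriorAlgebra.map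
    ((trivializationAt F A x₀).continuousLinearMapAt ℝ x : A x →ₗ[ℝ] F) (P x)

variable (E F) in
/-- A family `P x ∈ ⋀ (A x)` is a smooth section of the bundle `⋀ A` if, in the local
trivializations, all its components with respect to the finite-dimensional vector space `⋀ F` are
smooth functions. -/
def IsSmoothMultisection (P : ∀ x, ExteriorAlgebra ℝ (A x)) : Prop :=
  ∀ (x₀ : M) (φ : Module.Dual ℝ (ExteriorAlgebra ℝ F)),
    ContMDiffOn 𝓘(ℝ, E) 𝓘(ℝ, ℝ) ∞ (fun x => φ (localRep F x₀ P x)) (trivializationAt F A x₀).baseSet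

variable [FiniteDimensional ℝ F]

variable (F) in
/-- The basis of `⋀ F` attached to a basis of `F`. -/
def extBasis : Module.Basis (Finset (Fin (Module.finrank ℝ F))) ℝ (ExteriorAlgebra ℝ F) :=
  (Module.finBasis ℝ F).ExteriorAlgebra

theorem IsSmoothMultisection.mul {P Q : ∀ x, ExteriorAlgebra ℝ (A x)}
    (hP : IsSmoothMultisection E F P) (hQ : IsSmoothMultisection E F Q) :
    IsSmoothMultisection E F (P * Q) := by
  intro x₀ φ
  have key : ∀ x, φ (localRep F x₀ (P * Q) x) =
      ∑ i, ∑ j, (extBasis F).coord i (localRep F x₀ P x) *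
        (extBasis F).coord j (localRep F x₀ Q x) * φ (extBasis F i * extBasis F j) := by
    intro x
    have h : localRep F x₀ (P * Q) x = localRep F x₀ P x * localRep F x₀ Q x := by
      simp [localRep]
    rw [h]
    conv_lhs => rw [← (extBasis F).sum_repr (localRep F x₀ P x),
      ← (extBasis F).sum_repr (localRep F x₀ Q x)]
    simp only [Finset.sum_mul_sum, map_sum, smul_mul_smul_comm, map_smul, smul_eq_mul,
      Module.Basis.coord_apply]
  simp only [key]
  refine contMDiffOn_finsetSum fun i _ => contMDiffOn_finsetSum fun j _ => ?_
  exact ((hP x₀ _).mul (hQ x₀ _)).mul contMDiffOn_const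

variable (E F A) in
/-- The algebra `𝒜 = ⨁ₖ Γ(⋀ᵏ A) = Γ(⋀ A)` of smooth sections of the exterior algebra bundle of `A`,
with the pointwise wedge product. -/
def Multisection : Subalgebra ℝ (∀ x, ExteriorAlgebra ℝ (A x)) where
  carrier := {P | IsSmoothMultisection E F P}
  mul_mem' := IsSmoothMultisection.mul
  add_mem' := by
    intro P Q hP hQ x₀ φ
    have : ∀ x, φ (localRep F x₀ (P + Q) x) =
        φ (localRep F x₀ P x) + φ (localRep F x₀ Q x) := by
      intro x; simp [localRep]
    simp only [this]
    exact (hP x₀ φ).add (hQ x₀ φ)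
  algebraMap_mem' := by
    intro r x₀ φ
    have : ∀ x, φ (localRep F x₀ (algebraMap ℝ (∀ x, ExteriorAlgebra ℝ (A x)) r) x) =
        φ (algebraMap ℝ _ r) := by
      intro x; simp [localRep]
    simp only [this]
    exact contMDiffOn_const

variable (E F A) in
/-- The homogeneous part `𝒜ᵏ = Γ(⋀ᵏ A)`. -/
def multisectionDeg (k : ℕ) : Submodule ℝ (Multisection E F A) where
  carrier := {P | ∀ x, P.1 x ∈ ⋀[ℝ]^k (A x)}
  add_mem' hP hQ x := Submodule.add_mem _ (hP x) (hQ x)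
  zero_mem' _ := Submodule.zero_mem _
  smul_mem' r _ hP x := Submodule.smul_mem _ r (hP x)

/-- A smooth function, as an element of `𝒜⁰`. -/
def ofFunction (f : C^∞⟮𝓘(ℝ, E), M; 𝓘(ℝ, ℝ), ℝ⟯) : Multisection E F A :=
  ⟨fun x => algebraMap ℝ _ (f x), by
    intro x₀ φ
    have : ∀ x, φ (localRep F x₀ (fun x => algebraMap ℝ (ExteriorAlgebra ℝ (A x)) (f x)) x) =
        f x * φ 1 := by
      intro x; simp [localRep, Algebra.algebraMap_eq_smul_one]
    simp only [this]
    exact f.contMDiff.contMDiffOn.mul contMDiffOn_const⟩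

/-- The product `f • P` of a smooth function and an element of `Γ(⋀ᵏ A)`. -/
instance (k : ℕ) : SMul C^∞⟮𝓘(ℝ, E), M; 𝓘(ℝ, ℝ), ℝ⟯ (multisectionDeg E F A k) :=
  ⟨fun f P => ⟨ofFunction f * P.1, fun x => by
    have : (ofFunction f * P.1 : Multisection E F A).1 x = f x • P.1.1 x :=
      (Algebra.smul_def (f x) (P.1.1 x)).symm
    rw [this]
    exact Submodule.smul_mem _ _ (P.2 x)⟩⟩

variable [ContMDiffVectorBundle ∞ F A 𝓘(ℝ, E)]

/-- A smooth section of `A`, as an element of `𝒜¹`. -/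
def ofSection (X : Cₛ^∞⟮𝓘(ℝ, E); F, A⟯) : Multisection E F A :=
  ⟨fun x => ExteriorAlgebra.ι ℝ (X x), by
    intro x₀ φ
    set e := trivializationAt F A x₀
    have h1 : ContMDiffOn 𝓘(ℝ, E) 𝓘(ℝ, F) ∞ (fun x => (e ⟨x, X x⟩).2) e.baseSet :=
      (e.contMDiffOn_section_baseSet_iff).1 X.contMDiff.contMDiffOn
    have h2 := ((LinearMap.toContinuousLinearMap
      (φ ∘ₗ ExteriorAlgebra.ι ℝ : F →ₗ[ℝ] ℝ)).contMDiff (n := ∞)).comp_contMDiffOn h1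
    refine h2.congr fun x hx => ?_
    simp [localRep, e, Trivialization.continuousLinearMapAt_apply,
      Trivialization.linearMapAt_apply, hx]⟩

end Multisections

section LieAlgebroid

variable {E : Type*} [NormedAddCommGroup E] [NormedSpace ℝ E]
  {M : Type*} [TopologicalSpace M] [ChartedSpace E M]

variable (E) in
/-- The derivative `V f` of a function along a (not necessarily continuous) vector field. -/
def vfDeriv (V : ∀ x : M, TangentSpace 𝓘(ℝ, E) x) (f : M → ℝ) : M → ℝ :=
  fun x => mfderiv 𝓘(ℝ, E) 𝓘(ℝ, ℝ) f x (V x)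

variable (E) (F : Type*) [NormedAddCommGroup F] [NormedSpace ℝ F]
  (A : M → Type*) [TopologicalSpace (TotalSpace F A)] [∀ x, TopologicalSpace (A x)]
  [∀ x, AddCommGroup (A x)] [∀ x, Module ℝ (A x)] [FiberBundle F A] [VectorBundle ℝ F A]
  [IsManifold 𝓘(ℝ, E) ∞ M]

/-- A Lie algebroid structure on the smooth vector bundle `A` over `M`. -/
structure LieAlgebroid where
  /-- the Lie bracket of sections -/
  bracket : Cₛ^∞⟮𝓘(ℝ, E); F, A⟯ →ₗ[ℝ] Cₛ^∞⟮𝓘(ℝ, E); F, A⟯ →ₗ[ℝ] Cₛ^∞⟮𝓘(ℝ, E); F, A⟯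
  bracket_self : ∀ X, bracket X X = 0
  jacobi : ∀ X Y Z, bracket X (bracket Y Z) = bracket (bracket X Y) Z + bracket Y (bracket X Z)
  /-- the anchor `a : A → TM`, fibre by fibre -/
  anchor : ∀ x, A x →ₗ[ℝ] TangentSpace 𝓘(ℝ, E) x
  contMDiff_anchor :
    ContMDiff (𝓘(ℝ, E).prod 𝓘(ℝ, F)) 𝓘(ℝ, E).tangent ∞
      (fun p : TotalSpace F A => (⟨p.1, anchor p.1 p.2⟩ : TangentBundle 𝓘(ℝ, E) M))
  leibniz : ∀ (X Y : Cₛ^∞⟮𝓘(ℝ, E); F, A⟯) (f : C^∞⟮𝓘(ℝ, E), M; 𝓘(ℝ, ℝ), ℝ⟯) (x : M),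
    bracket X (f • Y) x = f x • bracket X Y x + vfDeriv E (fun y => anchor y (X y)) f x • Y x
  /-- the anchor intertwines the bracket of sections with the commutator of vector fields -/
  anchor_bracket : ∀ (X Y : Cₛ^∞⟮𝓘(ℝ, E); F, A⟯) (f : C^∞⟮𝓘(ℝ, E), M; 𝓘(ℝ, ℝ), ℝ⟯) (x : M),
    vfDeriv E (fun y => anchor y (bracket X Y y)) f x =
      vfDeriv E (fun y => anchor y (X y)) (vfDeriv E (fun y => anchor y (Y y)) f) x -
      vfDeriv E (fun y => anchor y (Y y)) (vfDeriv E (fun y => anchor y (X y)) f) x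

variable {E F A}
variable [FiniteDimensional ℝ E] [T2Space M] [ContMDiffVectorBundle ∞ F A 𝓘(ℝ, E)]

theorem exists_extendConst (x : M) (v : F) :
    ∃ X : Cₛ^∞⟮𝓘(ℝ, E); F, A⟯,
      ∀ᶠ y in 𝓝 x, X y = (trivializationAt F A x).symmL ℝ y v := by
  set e := trivializationAt F A x
  have hx : e.baseSet ∈ 𝓝 x := e.open_baseSet.mem_nhds (FiberBundle.mem_baseSet_trivializationAt' x)
  obtain ⟨χ, -, hχ⟩ := (SmoothBumpFunction.nhds_basis_tsupport (I := 𝓘(ℝ, E)) x).mem_iff.1 hx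
  have hloc : ContMDiffOn 𝓘(ℝ, E) (𝓘(ℝ, E).prod 𝓘(ℝ, F)) ∞
      (fun y => TotalSpace.mk' F y (e.symmL ℝ y v)) e.baseSet := by
    refine (e.contMDiffOn_section_baseSet_iff).2 ?_
    refine (contMDiffOn_const (c := v)).congr fun y hy => ?_
    rw [e.symmL_apply hy, e.apply_mk_symm hy]
  refine ⟨⟨fun y => χ y • e.symmL ℝ y v, ?_⟩, ?_⟩
  · intro y
    by_cases hy : y ∈ tsupport χ
    · have hy' := e.open_baseSet.mem_nhds (hχ hy)
      exact (χ.contMDiff.contMDiffAt).smul_section (hloc.contMDiffAt hy')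
    · have hz : (fun z => TotalSpace.mk' F z (χ z • e.symmL ℝ z v)) =ᶠ[𝓝 y]
          fun z => TotalSpace.mk' F z (0 : A z) := by
        filter_upwards [(isClosed_tsupport χ).isOpen_compl.mem_nhds hy] with z hz
        rw [image_eq_zero_of_notMem_tsupport hz, zero_smul]
      exact ((contMDiff_zeroSection ℝ A).contMDiffAt).congr_of_eventuallyEq hz
  · filter_upwards [χ.eventuallyEq_one] with y hy
    change χ y • e.symmL ℝ y v = _
    rw [hy, Pi.one_apply, one_smul]

/-- A global smooth section of `A` that is constantly equal to `v` near `x`, in the preferred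
trivialization of `A` around `x`. -/
def extendConst (x : M) (v : F) : Cₛ^∞⟮𝓘(ℝ, E); F, A⟯ :=
  (exists_extendConst x v).choose

variable [FiniteDimensional ℝ F]

namespace LieAlgebroid

variable (L : LieAlgebroid E F A)

/-- The section `eᵢ` of the local frame of `A` near `x` that the preferred trivialization at `x`
and a fixed basis of `F` determine. -/
def frame (x : M) (i : Fin (Module.finrank ℝ F)) : Cₛ^∞⟮𝓘(ℝ, E); F, A⟯ :=
  extendConst x (Module.finBasis ℝ F i)

/-- The derivative at `x` of the components of `P`, in the local frame near `x`, along the vector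
field `a(eᵢ)`. -/
def frameDeriv (x : M) (i : Fin (Module.finrank ℝ F)) (P : ∀ x, ExteriorAlgebra ℝ (A x)) :
    ExteriorAlgebra ℝ F :=
  ∑ s, vfDeriv E (fun y => L.anchor y ((frame x i : Cₛ^∞⟮𝓘(ℝ, E); F, A⟯) y))
    (fun y => (extBasis F).coord s (localRep F x P y)) x • extBasis F s

variable (F) in
/-- The derivative `∂/∂eᵢ` of `⋀ F` acting from the left:
`v₁ ∧ ⋯ ∧ vₚ ↦ ∑ₖ (-1)^(k-1) eⁱ(vₖ) v₁ ∧ ⋯ v̂ₖ ⋯ ∧ vₚ`. -/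
def leftContr (i : Fin (Module.finrank ℝ F)) (P : ExteriorAlgebra ℝ F) : ExteriorAlgebra ℝ F :=
  CliffordAlgebra.contractLeft (Q := (0 : QuadraticForm ℝ F)) ((Module.finBasis ℝ F).coord i) P

variable (F) in
/-- The derivative `∂/∂eᵢ` of `⋀ F` acting from the right:
`v₁ ∧ ⋯ ∧ vₚ ↦ ∑ₖ (-1)^(p-k) eⁱ(vₖ) v₁ ∧ ⋯ v̂ₖ ⋯ ∧ vₚ`. -/
def rightContr (i : Fin (Module.finrank ℝ F)) (P : ExteriorAlgebra ℝ F) : ExteriorAlgebra ℝ F :=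
  CliffordAlgebra.contractRight (Q := (0 : QuadraticForm ℝ F)) P ((Module.finBasis ℝ F).coord i)

/-- The (generalized) Schouten bracket of multisections of a Lie algebroid, i.e. the extension of
`[X, Y]`, `[X, f] = a(X) f` and `[f, g] = 0` by the graded Leibniz rule. At a point `x` it is given
by the usual formula in a local frame `eᵢ` near `x`:
`[P, Q] = ∑ᵢ (P ∂⃖ᵢ ∧ a(eᵢ)Q - a(eᵢ)P ∧ ∂⃗ᵢ Q) + ∑ᵢⱼ P ∂⃖ᵢ ∧ [eᵢ, eⱼ] ∧ ∂⃗ⱼ Q`,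
where `a(eᵢ)` differentiates components and `∂ᵢ` are the right and left contractions with the dual
frame. The value does not depend on the frame. -/
def schouten (P Q : Multisection E F A) (x : M) : ExteriorAlgebra ℝ (A x) :=
  ExteriorAlgebra.map ((trivializationAt F A x).symmL ℝ x : F →ₗ[ℝ] A x)
    (∑ i, (rightContr F i (localRep F x P.1 x) * L.frameDeriv x i Q.1
          - L.frameDeriv x i P.1 * leftContr F i (localRep F x Q.1 x))
      + ∑ i, ∑ j, rightContr F i (localRep F x P.1 x)
          * localRep F x (ofSection (L.bracket (frame x i) (frame x j))).1 x
          * leftContr F j (localRep F x Q.1 x))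

/-- The Lie derivative `L_X P = [X, P]` of a multisection along a section of `A`. -/
def lieDeriv (X : Cₛ^∞⟮𝓘(ℝ, E); F, A⟯) (P : Multisection E F A) (x : M) :
    ExteriorAlgebra ℝ (A x) :=
  L.schouten (ofSection X) P x

/-- An `A`-connection on the vector bundle `⋀ᵏ A`. -/
structure AConnection (k : ℕ) where
  /-- the operator `(X, s) ↦ ∇_X s` -/
  toFun : Cₛ^∞⟮𝓘(ℝ, E); F, A⟯ →ₗ[ℝ] multisectionDeg E F A k →ₗ[ℝ] multisectionDeg E F A k
  smul_left : ∀ (f : C^∞⟮𝓘(ℝ, E), M; 𝓘(ℝ, ℝ), ℝ⟯) X s, toFun (f • X) s = f • toFun X s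
  leibniz : ∀ (f : C^∞⟮𝓘(ℝ, E), M; 𝓘(ℝ, ℝ), ℝ⟯) (X : Cₛ^∞⟮𝓘(ℝ, E); F, A⟯)
    (s : multisectionDeg E F A k) (x : M),
    (toFun X (f • s)).1.1 x =
      vfDeriv E (fun y => L.anchor y (X y)) f x • s.1.1 x + f x • (toFun X s).1.1 x

variable {L}

/-- The curvature `R(X, Y) = ∇_X ∇_Y - ∇_Y ∇_X - ∇_[X, Y]`. -/
def AConnection.curvature {k : ℕ} (C : L.AConnection k) (X Y : Cₛ^∞⟮𝓘(ℝ, E); F, A⟯)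
    (s : multisectionDeg E F A k) : multisectionDeg E F A k :=
  C.toFun X (C.toFun Y s) - C.toFun Y (C.toFun X s) - C.toFun (L.bracket X Y) s

/-- Flatness of an `A`-connection. -/
def AConnection.IsFlat {k : ℕ} (C : L.AConnection k) : Prop :=
  ∀ X Y s, C.curvature X Y s = 0

variable (L)

/-- A Gerstenhaber generator: a linear operator of degree `-1` on `𝒜` that generates the Schouten
bracket, `[P, Q] = (-1)^|P| (D (P ∧ Q) - D P ∧ Q - (-1)^|P| P ∧ D Q)`. -/
structure IsGerstenhaberGenerator (D : Multisection E F A →ₗ[ℝ] Multisection E F A) : Prop where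
  map_zero_deg : ∀ P ∈ multisectionDeg E F A 0, D P = 0
  map_succ_deg : ∀ k, ∀ P ∈ multisectionDeg E F A (k + 1), D P ∈ multisectionDeg E F A k
  generates : ∀ k, ∀ P ∈ multisectionDeg E F A k, ∀ (Q : Multisection E F A) (x : M),
    L.schouten P Q x =
      (((-1 : ℝ) ^ k • (D (P * Q) - D P * Q - (-1 : ℝ) ^ k • (P * D Q)) : Multisection E F A)).1 x

/-- A BV-generator: a Gerstenhaber generator of square zero. -/
def IsBVGenerator (D : Multisection E F A →ₗ[ℝ] Multisection E F A) : Prop :=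
  L.IsGerstenhaberGenerator D ∧ D ∘ₗ D = 0

end LieAlgebroid

end LieAlgebroid

end AlgebroidBV

end

/-! A generator `D` kills functions, and its generating identity with a section `X` on the left
reads D(X∧Q) = DX∧Q − X∧DQ − L_X Q. Multisections are, near each point, sums of functions times
wedges of sections, and `D` is local, so `D` is determined by the functions div X = DX. The rule
that div has to satisfy is div(fX) = f div X − a(X)f.

Connections on the top power carry the same data. Both L_X and ∇_X obey the Leibniz rule with the
same derivation a(X), so L_X − ∇_X is function-linear on a line bundle, hence multiplication by a
function div X. Since L_{fX}Λ = f L_XΛ − (a(X)f)Λ in top degree, div obeys the rule above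
(`AConnection.exists_divergence`). Conversely, `divergenceGenerator` turns such a div into an
operator by an explicit formula in a local frame, a second-order operator whose failure to be a
derivation is the Schouten bracket; this is the pointwise identity
`schoutenSymbol_eq_generatorSymbol` in the exterior algebra. The two displayed formulas of the
theorem agree because X∧Λ = 0 in top degree (`IsGerstenhaberGenerator.section_mul_map`).

Bracket and generator are defined at each point in a frame chosen for that point. Independence of
the frame is never computed: values on functions and sections together with product rules determine
everything, through `multisection_induction` and `IsLocalOperator.eq_zero`.

For flatness, put K(X,Y) = div[X,Y] − a(X) div Y + a(Y) div X. The curvature of ∇ is multiplication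
by K. On the other side D²(X∧Q) = X∧D²Q − N_X Q, where N_X is local, kills functions and satisfies
N_X(Y∧Q) = K(X,Y)Q − Y∧N_X Q. So D² = 0 is also equivalent to K = 0. -/

noncomputable section

namespace AlgebroidBV

/-! ### Contractions in the exterior algebra and the pointwise generating identity -/

section ExteriorAlgebra

open CliffordAlgebra (contractLeft contractRight involute)

variable {R V : Type*} [CommRing R] [AddCommGroup V] [Module R V]

theorem contractLeft_mul (d : Module.Dual R V) (a b : ExteriorAlgebra R V) :
    contractLeft (Q := (0 : QuadraticForm R V)) d (a * b) =
      contractLeft (Q := (0 : QuadraticForm R V)) d a * b +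
        involute (Q := (0 : QuadraticForm R V)) a *
          contractLeft (Q := (0 : QuadraticForm R V)) d b := by
  induction a using CliffordAlgebra.left_induction with
  | algebraMap r =>
    simp [CliffordAlgebra.contractLeft_algebraMap_mul, CliffordAlgebra.contractLeft_algebraMap]
  | add a a' ha ha' => simp only [add_mul, map_add, ha, ha']; abel
  | ι_mul a v ha =>
    rw [mul_assoc, CliffordAlgebra.contractLeft_ι_mul, ha, CliffordAlgebra.contractLeft_ι_mul,
      map_mul, CliffordAlgebra.involute_ι]
    simp only [mul_add, sub_mul, smul_mul_assoc, mul_assoc, neg_mul]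
    abel

theorem ι_mul_eq_involute_mul (v : V) (a : ExteriorAlgebra R V) :
    ExteriorAlgebra.ι R v * a = involute (Q := (0 : QuadraticForm R V)) a * ExteriorAlgebra.ι R v := by
  induction a using CliffordAlgebra.left_induction with
  | algebraMap r => simpa using (Algebra.commutes r (ExteriorAlgebra.ι R v)).symm
  | add a a' ha ha' => simp only [mul_add, map_add, ha, ha', add_mul]
  | ι_mul a w ha =>
    have h := eq_neg_of_add_eq_zero_left (ExteriorAlgebra.ι_add_mul_swap (R := R) v w)
    rw [map_mul, CliffordAlgebra.involute_ι, mul_assoc, ← ha, ← mul_assoc, h]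
    simp only [neg_mul, mul_assoc]

/-- Both sides satisfy the same recursion under right multiplication by a vector. This removes right
contractions from the Schouten bracket, so that only the antiderivation rule of the left ones is
needed. -/
theorem contractRight_eq_involute (d : Module.Dual R V) (a : ExteriorAlgebra R V) :
    contractRight (Q := (0 : QuadraticForm R V)) a d =
      involute (Q := (0 : QuadraticForm R V))
        (contractLeft (Q := (0 : QuadraticForm R V)) d a) := by
  induction a using CliffordAlgebra.right_induction with
  | algebraMap r =>
    simp [CliffordAlgebra.contractRight_algebraMap, CliffordAlgebra.contractLeft_algebraMap]
  | add a a' ha ha' => simp only [map_add, ha, ha', LinearMap.add_apply]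
  | mul_ι a v ha =>
    rw [CliffordAlgebra.contractRight_mul_ι, contractLeft_mul, ha, map_add, map_mul, map_mul,
      CliffordAlgebra.involute_ι, CliffordAlgebra.contractLeft_ι, CliffordAlgebra.involute_involute,
      AlgHom.commutes, ← Algebra.commutes, ← Algebra.smul_def, mul_neg]
    abel

theorem involute_of_mem {k : ℕ} {a : ExteriorAlgebra R V} (ha : a ∈ ⋀[R]^k V) :
    involute (Q := (0 : QuadraticForm R V)) a = (-1 : R) ^ k • a := by
  induction k generalizing a with
  | zero =>
    obtain ⟨r, rfl⟩ := Submodule.mem_one.1 (by simpa using ha)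
    simp
  | succ k ih =>
    rw [ExteriorAlgebra.exteriorPower, pow_succ'] at ha
    induction ha using Submodule.mul_induction_on' with
    | mem_mul_mem v hv b hb =>
      obtain ⟨v, rfl⟩ := hv
      rw [map_mul, ih hb, CliffordAlgebra.involute_ι, pow_succ']
      simp
    | add a _ b _ ha hb => rw [map_add, ha, hb, smul_add]

theorem contractLeft_eq_zero_of_mem {a : ExteriorAlgebra R V} (ha : a ∈ ⋀[R]^0 V)
    (d : Module.Dual R V) : contractLeft (Q := (0 : QuadraticForm R V)) d a = 0 := by
  obtain ⟨r, rfl⟩ := Submodule.mem_one.1 (by simpa using ha)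
  exact CliffordAlgebra.contractLeft_algebraMap _ _ _

theorem ι_mul_mem {k : ℕ} {a : ExteriorAlgebra R V} (ha : a ∈ ⋀[R]^k V) (v : V) :
    ExteriorAlgebra.ι R v * a ∈ ⋀[R]^(k + 1) V := by
  rw [ExteriorAlgebra.exteriorPower, pow_succ']
  exact Submodule.mul_mem_mul ⟨v, rfl⟩ ha

theorem contractLeft_mem {k : ℕ} {a : ExteriorAlgebra R V} (ha : a ∈ ⋀[R]^(k + 1) V)
    (d : Module.Dual R V) :
    contractLeft (Q := (0 : QuadraticForm R V)) d a ∈ ⋀[R]^k V := by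
  induction k generalizing a with
  | zero =>
    obtain ⟨v, rfl⟩ : a ∈ LinearMap.range (ExteriorAlgebra.ι R) := by simpa [ExteriorAlgebra.exteriorPower] using ha
    rw [CliffordAlgebra.contractLeft_ι, ExteriorAlgebra.exteriorPower, pow_zero]
    exact Submodule.algebraMap_mem _
  | succ k ih =>
    rw [ExteriorAlgebra.exteriorPower, pow_succ'] at ha
    induction ha using Submodule.mul_induction_on' with
    | mem_mul_mem v hv b hb =>
      obtain ⟨v, rfl⟩ := hv
      rw [CliffordAlgebra.contractLeft_ι_mul]
      exact Submodule.sub_mem _ (Submodule.smul_mem _ _ hb) (ι_mul_mem (ih hb) v)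
    | add a _ b _ ha hb => rw [map_add]; exact Submodule.add_mem _ ha hb

theorem ι_mul_contractLeft_mem {k : ℕ} {a : ExteriorAlgebra R V} (ha : a ∈ ⋀[R]^k V)
    (d : Module.Dual R V) (v : V) :
    ExteriorAlgebra.ι R v * contractLeft (Q := (0 : QuadraticForm R V)) d a ∈ ⋀[R]^k V := by
  -- In degree zero the contraction itself vanishes, so the lost degree need not be restored by the
  -- vector.
  cases k with
  | zero => rw [contractLeft_eq_zero_of_mem ha, mul_zero]; exact Submodule.zero_mem _
  | succ k => exact ι_mul_mem (contractLeft_mem ha d) v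

theorem mem_exteriorPower_one {a : ExteriorAlgebra R V} (ha : a ∈ ⋀[R]^1 V) :
    ∃ v, a = ExteriorAlgebra.ι R v := by
  obtain ⟨v, rfl⟩ : a ∈ LinearMap.range (ExteriorAlgebra.ι R) := by simpa [ExteriorAlgebra.exteriorPower] using ha
  exact ⟨v, rfl⟩

variable {I : Type*} [Fintype I]

/-- The Schouten bracket of two polyvectors with values `p`, `q` and derivatives `dp`, `dq` along a
frame whose dual coframe is `d` and whose brackets are `e`. -/
def schoutenSymbol (d : I → Module.Dual R V) (e : I → I → ExteriorAlgebra R V)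
    (p : ExteriorAlgebra R V) (dp : I → ExteriorAlgebra R V)
    (q : ExteriorAlgebra R V) (dq : I → ExteriorAlgebra R V) : ExteriorAlgebra R V :=
  ∑ i, (contractRight (Q := (0 : QuadraticForm R V)) p (d i) * dq i
      - dp i * contractLeft (Q := (0 : QuadraticForm R V)) (d i) q)
    + ∑ i, ∑ j, contractRight (Q := (0 : QuadraticForm R V)) p (d i) * e i j
      * contractLeft (Q := (0 : QuadraticForm R V)) (d j) q

/-- The generator of the Schouten bracket, in a frame with dual coframe `d` and brackets `e`, whose
value on the frame is `c`. -/
def generatorSymbol [Invertible (2 : R)] (d : I → Module.Dual R V)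
    (e : I → I → ExteriorAlgebra R V)
    (c : I → R) (p : ExteriorAlgebra R V) (dp : I → ExteriorAlgebra R V) : ExteriorAlgebra R V :=
  -(∑ i, contractLeft (Q := (0 : QuadraticForm R V)) (d i) (dp i))
    + (⅟2 : R) • (∑ i, ∑ j, e i j * contractLeft (Q := (0 : QuadraticForm R V)) (d i)
        (contractLeft (Q := (0 : QuadraticForm R V)) (d j) p))
    + ∑ i, c i • contractLeft (Q := (0 : QuadraticForm R V)) (d i) p

/-- The Schouten bracket with a vector is a derivation. -/
theorem schoutenSymbol_ι_mul (d : I → Module.Dual R V) (e : I → I → V)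
    (v : V) (dv : I → V) (p q : ExteriorAlgebra R V) (dp dq : I → ExteriorAlgebra R V) :
    schoutenSymbol d (fun i j => ExteriorAlgebra.ι R (e i j)) (ExteriorAlgebra.ι R v)
        (fun i => ExteriorAlgebra.ι R (dv i)) (p * q) (fun i => dp i * q + p * dq i) =
      schoutenSymbol d (fun i j => ExteriorAlgebra.ι R (e i j)) (ExteriorAlgebra.ι R v)
        (fun i => ExteriorAlgebra.ι R (dv i)) p dp * q +
      p * schoutenSymbol d (fun i j => ExteriorAlgebra.ι R (e i j)) (ExteriorAlgebra.ι R v)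
        (fun i => ExteriorAlgebra.ι R (dv i)) q dq := by
  -- Contraction followed by multiplication with a vector is an untwisted derivation: the sign from
  -- the contraction cancels the sign from moving `w` past `p`.
  have key : ∀ (w : V) (i : I), ExteriorAlgebra.ι R w *
      contractLeft (Q := (0 : QuadraticForm R V)) (d i) (p * q) =
      ExteriorAlgebra.ι R w * contractLeft (Q := (0 : QuadraticForm R V)) (d i) p * q +
      p * (ExteriorAlgebra.ι R w * contractLeft (Q := (0 : QuadraticForm R V)) (d i) q) := by
    intro w i
    rw [contractLeft_mul, mul_add, ← mul_assoc, ← mul_assoc, ι_mul_eq_involute_mul w (involute _),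
      CliffordAlgebra.involute_involute, mul_assoc p]
  simp only [schoutenSymbol, CliffordAlgebra.contractRight_ι, ← Algebra.smul_def, smul_mul_assoc,
    key, add_mul, mul_add, Finset.sum_mul, Finset.mul_sum, smul_add, mul_smul_comm, sub_mul, mul_sub,
    Finset.sum_add_distrib, Finset.sum_sub_distrib]
  abel

theorem involute_contractLeft (d : Module.Dual R V) (a : ExteriorAlgebra R V) :
    involute (Q := (0 : QuadraticForm R V)) (contractLeft (Q := (0 : QuadraticForm R V)) d a) =
      -contractLeft (Q := (0 : QuadraticForm R V)) d (involute (Q := (0 : QuadraticForm R V)) a) := by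
  induction a using CliffordAlgebra.left_induction with
  | algebraMap r => simp [CliffordAlgebra.contractLeft_algebraMap]
  | add a a' ha ha' => simp only [map_add, ha, ha']; abel
  | ι_mul a v ha =>
    rw [CliffordAlgebra.contractLeft_ι_mul, map_sub, map_smul, map_mul, ha, map_mul,
      CliffordAlgebra.involute_ι, neg_mul, neg_mul, map_neg, CliffordAlgebra.contractLeft_ι_mul]
    simp only [mul_neg]
    abel

/-- The operator with symbol `generatorSymbol` generates the bracket with symbol
`schoutenSymbol`. -/
theorem schoutenSymbol_eq_generatorSymbol [Invertible (2 : R)] (d : I → Module.Dual R V)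
    (e : I → I → V) (he : ∀ i j, e i j = -e j i) (c : I → R) {s : R} (hs : s * s = 1)
    {p : ExteriorAlgebra R V} {dp : I → ExteriorAlgebra R V}
    (hp : involute (Q := (0 : QuadraticForm R V)) p = s • p)
    (hdp : ∀ i, involute (Q := (0 : QuadraticForm R V)) (dp i) = s • dp i)
    (q : ExteriorAlgebra R V) (dq : I → ExteriorAlgebra R V) :
    schoutenSymbol d (fun i j => ExteriorAlgebra.ι R (e i j)) p dp q dq =
      s • (generatorSymbol d (fun i j => ExteriorAlgebra.ι R (e i j)) c (p * q)
            (fun i => dp i * q + p * dq i)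
          - generatorSymbol d (fun i j => ExteriorAlgebra.ι R (e i j)) c p dp * q
          - s • (p * generatorSymbol d (fun i j => ExteriorAlgebra.ι R (e i j)) c q dq)) := by
  -- The scalar `s` plays the part of (−1)^|P|; only its square and its action through the grading
  -- involution matter.
  have hss : ∀ a : ExteriorAlgebra R V, s • s • a = a := fun a => by rw [smul_smul, hs, one_smul]
  have hdip : ∀ i, involute (Q := (0 : QuadraticForm R V))
      (contractLeft (Q := (0 : QuadraticForm R V)) (d i) p) =
      -(s • contractLeft (Q := (0 : QuadraticForm R V)) (d i) p) := fun i => by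
    rw [involute_contractLeft, hp, map_smul]
  set D : I → ExteriorAlgebra R V → ExteriorAlgebra R V :=
    fun i a => contractLeft (Q := (0 : QuadraticForm R V)) (d i) a with hD
  have first : ∀ i, D i (dp i * q + p * dq i) =
      D i (dp i) * q + s • (dp i * D i q) + (D i p * dq i + s • (p * D i (dq i))) := fun i => by
    simp only [hD, map_add, contractLeft_mul, hp, hdp, smul_mul_assoc]
  -- A product of two contractions is a second-order operator: besides the two derivation terms
  -- there are two cross terms, which carry the bracket part of `schoutenSymbol`.
  have second : ∀ i j, ExteriorAlgebra.ι R (e i j) * D i (D j (p * q)) =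
      ExteriorAlgebra.ι R (e i j) * D i (D j p) * q
      - s • (ExteriorAlgebra.ι R (e i j) * (D j p * D i q))
      + s • (ExteriorAlgebra.ι R (e i j) * (D i p * D j q))
      + s • (p * (ExteriorAlgebra.ι R (e i j) * D i (D j q))) := fun i j => by
    have hep : ExteriorAlgebra.ι R (e i j) * (p * D i (D j q)) =
        s • (p * (ExteriorAlgebra.ι R (e i j) * D i (D j q))) := by
      rw [← mul_assoc, ι_mul_eq_involute_mul, hp, smul_mul_assoc, smul_mul_assoc, mul_assoc]
    rw [← hep]
    simp only [hD, contractLeft_mul, map_add, hp, hdip, smul_mul_assoc, map_smul, smul_add, hss,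
      neg_mul, mul_add, mul_neg, mul_smul_comm, mul_assoc]
    abel
  have third : ∀ i, D i (p * q) = D i p * q + s • (p * D i q) := fun i => by
    simp only [hD, contractLeft_mul, hp, smul_mul_assoc]
  -- Antisymmetry of `e` makes the two cross terms equal after summation, which is why the generator
  -- carries the factor one half.
  have swap : ∑ i, ∑ j, ExteriorAlgebra.ι R (e i j) * (D j p * D i q) =
      -∑ i, ∑ j, ExteriorAlgebra.ι R (e i j) * (D i p * D j q) := by
    rw [Finset.sum_comm, ← Finset.sum_neg_distrib]
    refine Finset.sum_congr rfl fun i _ => ?_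
    rw [← Finset.sum_neg_distrib]
    refine Finset.sum_congr rfl fun j _ => ?_
    rw [he j i, map_neg, neg_mul]
  have half : ∀ a : ExteriorAlgebra R V, (⅟2 : R) • (a + a) = a := fun a => by
    rw [← two_smul R a, smul_smul, invOf_mul_self, one_smul]
  have bracket : ∀ i j, contractRight (Q := (0 : QuadraticForm R V)) p (d i) *
      ExteriorAlgebra.ι R (e i j) * D j q = ExteriorAlgebra.ι R (e i j) * (D i p * D j q) :=
    fun i j => by
      rw [contractRight_eq_involute, ← mul_assoc (ExteriorAlgebra.ι R (e i j)),
        ι_mul_eq_involute_mul]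
  have right : ∀ i, contractRight (Q := (0 : QuadraticForm R V)) p (d i) = -(s • D i p) :=
    fun i => by rw [contractRight_eq_involute, hdip]
  have T2 : (⅟2 : R) • (∑ i, ∑ j, ExteriorAlgebra.ι R (e i j) * D i (D j (p * q))) =
      (⅟2 : R) • (∑ i, ∑ j, ExteriorAlgebra.ι R (e i j) * D i (D j p)) * q
      + s • (∑ i, ∑ j, ExteriorAlgebra.ι R (e i j) * (D i p * D j q))
      + s • (p * (⅟2 : R) • (∑ i, ∑ j, ExteriorAlgebra.ι R (e i j) * D i (D j q))) := by
    simp only [second, Finset.sum_add_distrib, Finset.sum_sub_distrib, ← Finset.smul_sum, swap,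
      ← Finset.sum_mul, ← Finset.mul_sum]
    conv_rhs => rw [← half (s • ∑ i, ∑ j, ExteriorAlgebra.ι R (e i j) * (D i p * D j q))]
    simp only [smul_add, smul_neg, sub_neg_eq_add, smul_mul_assoc, mul_smul_comm,
      smul_comm s (⅟2 : R)]
    abel
  have T1 : ∑ i, D i (dp i * q + p * dq i) = (∑ i, D i (dp i)) * q + s • (∑ i, dp i * D i q)
      + ∑ i, D i p * dq i + s • (p * ∑ i, D i (dq i)) := by
    simp only [first, Finset.sum_add_distrib, Finset.sum_mul, Finset.mul_sum, Finset.smul_sum]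
    abel
  -- The part with `c` is an antiderivation and drops out of the identity, so the values on the
  -- frame are free: this freedom is the choice of a divergence.
  have T3 : ∑ i, c i • D i (p * q) = (∑ i, c i • D i p) * q + s • (p * ∑ i, c i • D i q) := by
    simp only [third, smul_add, Finset.sum_add_distrib, Finset.sum_mul, Finset.mul_sum,
      Finset.smul_sum, smul_mul_assoc, mul_smul_comm, smul_comm s]
  change ∑ i, (contractRight (Q := (0 : QuadraticForm R V)) p (d i) * dq i - dp i * D i q) +
      ∑ i, ∑ j, contractRight (Q := (0 : QuadraticForm R V)) p (d i) *
        ExteriorAlgebra.ι R (e i j) * D j q =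
    s • ((-(∑ i, D i (dp i * q + p * dq i))
        + (⅟2 : R) • (∑ i, ∑ j, ExteriorAlgebra.ι R (e i j) * D i (D j (p * q)))
        + ∑ i, c i • D i (p * q))
      - (-(∑ i, D i (dp i)) + (⅟2 : R) • (∑ i, ∑ j, ExteriorAlgebra.ι R (e i j) * D i (D j p))
        + ∑ i, c i • D i p) * q
      - s • (p * (-(∑ i, D i (dq i))
        + (⅟2 : R) • (∑ i, ∑ j, ExteriorAlgebra.ι R (e i j) * D i (D j q))
        + ∑ i, c i • D i q)))
  simp only [bracket]
  simp only [T1, T2, T3, right, Finset.sum_sub_distrib, add_mul, mul_add, smul_add,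
    smul_sub, smul_neg, neg_mul, mul_neg, hss, ← Finset.smul_sum, smul_mul_assoc,
    Finset.sum_neg_distrib]
  abel

end ExteriorAlgebra

/-! ### Directional derivatives of functions with values in the exterior algebra -/

section CoefficientDerivative

variable {E : Type*} [NormedAddCommGroup E] [NormedSpace ℝ E]
  {M : Type*} [TopologicalSpace M] [ChartedSpace E M]
  {F : Type*} [NormedAddCommGroup F] [NormedSpace ℝ F]

/-- The derivative of a real function along a tangent vector, as a real number. -/
def dirDeriv {x : M} (v : TangentSpace 𝓘(ℝ, E) x) (f : M → ℝ) : ℝ :=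
  mfderiv 𝓘(ℝ, E) 𝓘(ℝ, ℝ) f x v

theorem dirDeriv_congr {x : M} (v : TangentSpace 𝓘(ℝ, E) x) {f g : M → ℝ} (h : f =ᶠ[𝓝 x] g) :
    dirDeriv v f = dirDeriv v g := by
  unfold dirDeriv
  rw [h.mfderiv_eq]
  rfl

theorem dirDeriv_const {x : M} (v : TangentSpace 𝓘(ℝ, E) x) (r : ℝ) :
    dirDeriv v (fun _ => r) = 0 := by
  unfold dirDeriv
  rw [mfderiv_const]
  rfl

theorem dirDeriv_add {x : M} (v : TangentSpace 𝓘(ℝ, E) x) {f g : M → ℝ}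
    (hf : MDifferentiableAt 𝓘(ℝ, E) 𝓘(ℝ, ℝ) f x) (hg : MDifferentiableAt 𝓘(ℝ, E) 𝓘(ℝ, ℝ) g x) :
    dirDeriv v (fun y => f y + g y) = dirDeriv v f + dirDeriv v g := by
  change mfderiv 𝓘(ℝ, E) 𝓘(ℝ, ℝ) (f + g) x v = _
  rw [mfderiv_add hf hg]
  rfl

theorem dirDeriv_mul {x : M} (v : TangentSpace 𝓘(ℝ, E) x) {f g : M → ℝ}
    (hf : MDifferentiableAt 𝓘(ℝ, E) 𝓘(ℝ, ℝ) f x) (hg : MDifferentiableAt 𝓘(ℝ, E) 𝓘(ℝ, ℝ) g x) :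
    dirDeriv v (fun y => f y * g y) = f x * dirDeriv v g + g x * dirDeriv v f := by
  change mfderiv 𝓘(ℝ, E) 𝓘(ℝ, ℝ) (f * g) x v = _
  rw [(hf.hasMFDerivAt.mul hg.hasMFDerivAt).mfderiv]
  rfl

theorem mdifferentiableAt_sum_mul_const {ι : Type*} (t : Finset ι) {x : M} {f : ι → M → ℝ}
    (a : ι → ℝ) (hf : ∀ i ∈ t, MDifferentiableAt 𝓘(ℝ, E) 𝓘(ℝ, ℝ) (f i) x) :
    MDifferentiableAt 𝓘(ℝ, E) 𝓘(ℝ, ℝ) (fun y => ∑ i ∈ t, f i y * a i) x := by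
  classical
  induction t using Finset.induction_on with
  | empty => simpa using mdifferentiableAt_const
  | insert i t hi ih =>
    simp only [Finset.sum_insert hi]
    exact ((hf i (Finset.mem_insert_self _ _)).mul mdifferentiableAt_const).add
      (ih fun j hj => hf j (Finset.mem_insert_of_mem hj))

theorem dirDeriv_sum_mul_const {ι : Type*} (t : Finset ι) {x : M} (v : TangentSpace 𝓘(ℝ, E) x)
    {f : ι → M → ℝ} (a : ι → ℝ) (hf : ∀ i ∈ t, MDifferentiableAt 𝓘(ℝ, E) 𝓘(ℝ, ℝ) (f i) x) :
    dirDeriv v (fun y => ∑ i ∈ t, f i y * a i) = ∑ i ∈ t, dirDeriv v (f i) * a i := by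
  classical
  induction t using Finset.induction_on with
  | empty => simpa using dirDeriv_const v 0
  | insert i t hi ih =>
    have hi' := hf i (Finset.mem_insert_self _ _)
    have ht : ∀ j ∈ t, MDifferentiableAt 𝓘(ℝ, E) 𝓘(ℝ, ℝ) (f j) x :=
      fun j hj => hf j (Finset.mem_insert_of_mem hj)
    have hia : MDifferentiableAt 𝓘(ℝ, E) 𝓘(ℝ, ℝ) (fun y => f i y * a i) x :=
      hi'.mul mdifferentiableAt_const
    simp only [Finset.sum_insert hi]
    rw [dirDeriv_add v hia (mdifferentiableAt_sum_mul_const t a ht), ih ht,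
      dirDeriv_mul v hi' mdifferentiableAt_const, dirDeriv_const]
    ring

variable (E) in
/-- All components of the `⋀ F`-valued function `p` are differentiable at `x`. -/
def CoefDifferentiableAt (p : M → ExteriorAlgebra ℝ F) (x : M) : Prop :=
  ∀ φ : Module.Dual ℝ (ExteriorAlgebra ℝ F),
    MDifferentiableAt 𝓘(ℝ, E) 𝓘(ℝ, ℝ) (fun y => φ (p y)) x

theorem CoefDifferentiableAt.add {x : M} {p q : M → ExteriorAlgebra ℝ F}
    (hp : CoefDifferentiableAt E p x) (hq : CoefDifferentiableAt E q x) :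
    CoefDifferentiableAt E (fun y => p y + q y) x := fun φ => by
  simp only [map_add]
  exact (hp φ).add (hq φ)

variable [FiniteDimensional ℝ F]

/-- The componentwise derivative at `x` of a `⋀ F`-valued function along a tangent vector. -/
def coefDeriv {x : M} (v : TangentSpace 𝓘(ℝ, E) x) (p : M → ExteriorAlgebra ℝ F) :
    ExteriorAlgebra ℝ F :=
  ∑ s, dirDeriv v (fun y => (extBasis F).coord s (p y)) • extBasis F s

theorem coefDeriv_congr {x : M} (v : TangentSpace 𝓘(ℝ, E) x) {p q : M → ExteriorAlgebra ℝ F}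
    (h : p =ᶠ[𝓝 x] q) : coefDeriv v p = coefDeriv v q := by
  unfold coefDeriv
  exact Finset.sum_congr rfl fun s _ => congrArg (· • extBasis F s)
    (dirDeriv_congr v (h.fun_comp ((extBasis F).coord s)))

theorem dual_eq_sum (φ : Module.Dual ℝ (ExteriorAlgebra ℝ F)) (a : ExteriorAlgebra ℝ F) :
    φ a = ∑ s, (extBasis F).coord s a * φ (extBasis F s) := by
  conv_lhs => rw [← (extBasis F).sum_repr a]
  simp only [map_sum, map_smul, smul_eq_mul, Module.Basis.coord_apply]

theorem dual_mul_eq_sum (φ : Module.Dual ℝ (ExteriorAlgebra ℝ F)) (a b : ExteriorAlgebra ℝ F) :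
    φ (a * b) = ∑ st : Finset (Fin (Module.finrank ℝ F)) × Finset (Fin (Module.finrank ℝ F)),
      (extBasis F).coord st.1 a * (extBasis F).coord st.2 b *
        φ (extBasis F st.1 * extBasis F st.2) := by
  conv_lhs => rw [← (extBasis F).sum_repr a, ← (extBasis F).sum_repr b]
  simp only [Finset.sum_mul_sum, map_sum, smul_mul_smul_comm, map_smul, smul_eq_mul,
    Module.Basis.coord_apply, Fintype.sum_prod_type]

/-- Every functional is a constant combination of the coordinates used in `coefDeriv`. The
characterisation is free of the basis, and the sum and product rules follow by testing against
functionals. -/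
theorem dual_coefDeriv {x : M} (v : TangentSpace 𝓘(ℝ, E) x) {p : M → ExteriorAlgebra ℝ F}
    (hp : CoefDifferentiableAt E p x) (φ : Module.Dual ℝ (ExteriorAlgebra ℝ F)) :
    φ (coefDeriv v p) = dirDeriv v (fun y => φ (p y)) := by
  have e : (fun y => φ (p y)) =
      fun y => ∑ s, (extBasis F).coord s (p y) * φ (extBasis F s) := funext fun y => dual_eq_sum φ _
  rw [e, dirDeriv_sum_mul_const _ v _ fun s _ => hp ((extBasis F).coord s)]
  simp only [coefDeriv, map_sum, map_smul, smul_eq_mul]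

theorem dual_ext {a b : ExteriorAlgebra ℝ F}
    (h : ∀ φ : Module.Dual ℝ (ExteriorAlgebra ℝ F), φ a = φ b) : a = b :=
  (extBasis F).ext_elem fun i => h ((extBasis F).coord i)

theorem coefDeriv_add {x : M} (v : TangentSpace 𝓘(ℝ, E) x) {p q : M → ExteriorAlgebra ℝ F}
    (hp : CoefDifferentiableAt E p x) (hq : CoefDifferentiableAt E q x) :
    coefDeriv v (fun y => p y + q y) = coefDeriv v p + coefDeriv v q := by
  refine dual_ext fun φ => ?_
  rw [map_add, dual_coefDeriv v (hp.add hq), dual_coefDeriv v hp, dual_coefDeriv v hq]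
  simp only [map_add]
  exact dirDeriv_add v (hp φ) (hq φ)

theorem CoefDifferentiableAt.mul {x : M} {p q : M → ExteriorAlgebra ℝ F}
    (hp : CoefDifferentiableAt E p x) (hq : CoefDifferentiableAt E q x) :
    CoefDifferentiableAt E (fun y => p y * q y) x := fun φ => by
  simp only [dual_mul_eq_sum φ (p _)]
  exact mdifferentiableAt_sum_mul_const _ _ fun st _ =>
    (hp ((extBasis F).coord st.1)).mul (hq ((extBasis F).coord st.2))

theorem coefDeriv_mul {x : M} (v : TangentSpace 𝓘(ℝ, E) x) {p q : M → ExteriorAlgebra ℝ F}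
    (hp : CoefDifferentiableAt E p x) (hq : CoefDifferentiableAt E q x) :
    coefDeriv v (fun y => p y * q y) = coefDeriv v p * q x + p x * coefDeriv v q := by
  refine dual_ext fun φ => ?_
  rw [map_add, dual_coefDeriv v (hp.mul hq), dual_mul_eq_sum, dual_mul_eq_sum]
  simp only [dual_mul_eq_sum φ (p _)]
  rw [dirDeriv_sum_mul_const _ v _ fun st _ => (hp ((extBasis F).coord st.1)).mul
    (hq ((extBasis F).coord st.2)), ← Finset.sum_add_distrib]
  refine Finset.sum_congr rfl fun st _ => ?_
  rw [dual_coefDeriv v hp, dual_coefDeriv v hq,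
    dirDeriv_mul v (hp ((extBasis F).coord st.1)) (hq ((extBasis F).coord st.2))]
  ring

theorem coefDeriv_algebraMap {x : M} (v : TangentSpace 𝓘(ℝ, E) x) {f : M → ℝ}
    (hf : MDifferentiableAt 𝓘(ℝ, E) 𝓘(ℝ, ℝ) f x) :
    coefDeriv v (fun y => algebraMap ℝ (ExteriorAlgebra ℝ F) (f y)) =
      algebraMap ℝ _ (dirDeriv v f) := by
  have h : CoefDifferentiableAt E (fun y => algebraMap ℝ (ExteriorAlgebra ℝ F) (f y)) x :=
    fun φ => by
      simp only [Algebra.algebraMap_eq_smul_one, map_smul]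
      exact hf.mul mdifferentiableAt_const
  refine dual_ext fun φ => ?_
  rw [dual_coefDeriv v h]
  simp only [Algebra.algebraMap_eq_smul_one, map_smul, smul_eq_mul]
  rw [dirDeriv_mul v hf mdifferentiableAt_const, dirDeriv_const]
  ring

/-- A subspace is an intersection of kernels of functionals, and a functional that kills `p` near
`x` kills its derivative. The application is that differentiating components preserves the degree.
-/
theorem coefDeriv_mem {x : M} (v : TangentSpace 𝓘(ℝ, E) x) {p : M → ExteriorAlgebra ℝ F}
    (hp : CoefDifferentiableAt E p x) {S : Submodule ℝ (ExteriorAlgebra ℝ F)}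
    (h : ∀ᶠ y in 𝓝 x, p y ∈ S) : coefDeriv v p ∈ S := by
  by_contra hn
  obtain ⟨φ, hφ, hS⟩ := Submodule.exists_le_ker_of_notMem hn
  apply hφ
  have e : (fun y => φ (p y)) =ᶠ[𝓝 x] fun _ => (0 : ℝ) := h.mono fun y hy => hS hy
  rw [dual_coefDeriv v hp, dirDeriv_congr v e, dirDeriv_const]

end CoefficientDerivative

/-! ### Cutoffs, local representatives and induction on germs of multisections -/

section Germs

variable {E : Type*} [NormedAddCommGroup E] [NormedSpace ℝ E]
  {M : Type*} [TopologicalSpace M] [ChartedSpace E M]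
  {F : Type*} [NormedAddCommGroup F] [NormedSpace ℝ F]
  {A : M → Type*} [TopologicalSpace (TotalSpace F A)] [∀ x, TopologicalSpace (A x)]
  [∀ x, AddCommGroup (A x)] [∀ x, Module ℝ (A x)] [FiberBundle F A] [VectorBundle ℝ F A]

theorem eventually_mem_baseSet {F : Type*} [TopologicalSpace F] {A : M → Type*}
    [TopologicalSpace (TotalSpace F A)] [∀ x, TopologicalSpace (A x)] [FiberBundle F A] (x : M) :
    ∀ᶠ y in 𝓝 x, y ∈ (trivializationAt F A x).baseSet :=
  (trivializationAt F A x).open_baseSet.mem_nhds (FiberBundle.mem_baseSet_trivializationAt' x)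

theorem exists_cutoff [FiniteDimensional ℝ E] [T2Space M] [IsManifold 𝓘(ℝ, E) ∞ M] {x : M}
    {U : Set M} (hU : U ∈ 𝓝 x) :
    ∃ χ : C^∞⟮𝓘(ℝ, E), M; 𝓘(ℝ, ℝ), ℝ⟯, (∀ᶠ y in 𝓝 x, χ y = 1) ∧ tsupport χ ⊆ U := by
  obtain ⟨χ, -, hχ⟩ := (SmoothBumpFunction.nhds_basis_tsupport (I := 𝓘(ℝ, E)) x).mem_iff.1 hU
  exact ⟨⟨χ, χ.contMDiff⟩, χ.eventuallyEq_one, hχ⟩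

theorem exists_smooth_eventuallyEq [FiniteDimensional ℝ E] [T2Space M] [IsManifold 𝓘(ℝ, E) ∞ M]
    {x : M} {U : Set M} (hU : IsOpen U) (hx : x ∈ U) {f : M → ℝ}
    (hf : ContMDiffOn 𝓘(ℝ, E) 𝓘(ℝ, ℝ) ∞ f U) :
    ∃ g : C^∞⟮𝓘(ℝ, E), M; 𝓘(ℝ, ℝ), ℝ⟯, ∀ᶠ y in 𝓝 x, g y = f y := by
  obtain ⟨χ, h1, hχ⟩ := exists_cutoff (E := E) (hU.mem_nhds hx)
  refine ⟨⟨fun y => χ y * f y, fun y => ?_⟩, h1.mono fun y hy => ?_⟩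
  · by_cases hy : y ∈ tsupport χ
    · exact χ.contMDiff.contMDiffAt.mul (hf.contMDiffAt (hU.mem_nhds (hχ hy)))
    · refine (contMDiffAt_const (c := (0 : ℝ))).congr_of_eventuallyEq ?_
      filter_upwards [(isClosed_tsupport χ).isOpen_compl.mem_nhds hy] with z hz
      rw [image_eq_zero_of_notMem_tsupport hz, zero_mul]
  · change χ y * f y = f y
    rw [hy, one_mul]

theorem localRep_mul (x₀ : M) (P Q : ∀ x, ExteriorAlgebra ℝ (A x)) (y : M) :
    localRep F x₀ (P * Q) y = localRep F x₀ P y * localRep F x₀ Q y :=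
  map_mul _ _ _

theorem localRep_add (x₀ : M) (P Q : ∀ x, ExteriorAlgebra ℝ (A x)) (y : M) :
    localRep F x₀ (P + Q) y = localRep F x₀ P y + localRep F x₀ Q y :=
  map_add _ _ _

theorem map_symmL_localRep {x₀ y : M} (hy : y ∈ (trivializationAt F A x₀).baseSet)
    (P : ∀ x, ExteriorAlgebra ℝ (A x)) :
    ExteriorAlgebra.map ((trivializationAt F A x₀).symmL ℝ y : F →ₗ[ℝ] A y)
      (localRep F x₀ P y) = P y := by
  have h : ((trivializationAt F A x₀).symmL ℝ y : F →ₗ[ℝ] A y) ∘ₗ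
      ((trivializationAt F A x₀).continuousLinearMapAt ℝ y : A y →ₗ[ℝ] F) = LinearMap.id :=
    LinearMap.ext fun v => (trivializationAt F A x₀).symmL_continuousLinearMapAt hy v
  rw [localRep, ← AlgHom.comp_apply, ExteriorAlgebra.map_comp_map, h, ExteriorAlgebra.map_id]
  rfl

theorem map_mem_exteriorPower {V W : Type*} [AddCommGroup V] [Module ℝ V] [AddCommGroup W]
    [Module ℝ W] (T : V →ₗ[ℝ] W) {k : ℕ} {a : ExteriorAlgebra ℝ V} (ha : a ∈ ⋀[ℝ]^k V) :
    ExteriorAlgebra.map T a ∈ ⋀[ℝ]^k W := by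
  have h : (⋀[ℝ]^k V).map (ExteriorAlgebra.map T).toLinearMap ≤ ⋀[ℝ]^k W := by
    rw [ExteriorAlgebra.exteriorPower, Submodule.map_pow, ExteriorAlgebra.ι_range_map_map]
    exact pow_le_pow_left' (LinearMap.range_comp_le_range T (ExteriorAlgebra.ι ℝ) |>.trans' (by
      rw [LinearMap.range_comp])) k
  exact h ⟨a, ha, rfl⟩

theorem eq_of_localRep_eq {x₀ y : M} (hy : y ∈ (trivializationAt F A x₀).baseSet)
    {P Q : ∀ x, ExteriorAlgebra ℝ (A x)} (h : localRep F x₀ P y = localRep F x₀ Q y) :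
    P y = Q y := by
  rw [← map_symmL_localRep hy P, h, map_symmL_localRep hy]

theorem localRep_congr {x₀ y : M} {P Q : ∀ x, ExteriorAlgebra ℝ (A x)} (h : P y = Q y) :
    localRep F x₀ P y = localRep F x₀ Q y := by
  rw [localRep, localRep, h]

theorem localRep_smul (x₀ : M) (r : ℝ) {y : M} {P Q : ∀ x, ExteriorAlgebra ℝ (A x)}
    (h : P y = r • Q y) : localRep F x₀ P y = r • localRep F x₀ Q y := by
  rw [localRep, h, map_smul, localRep]

/-- A family which near each point agrees with a smooth multisection is smooth. -/
theorem IsSmoothMultisection.of_eventuallyEq {P : ∀ x, ExteriorAlgebra ℝ (A x)}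
    (h : ∀ z, ∃ Q, IsSmoothMultisection E F Q ∧ ∀ᶠ y in 𝓝 z, P y = Q y) :
    IsSmoothMultisection E F P := by
  intro x₀ φ z hz
  obtain ⟨Q, hQ, hPQ⟩ := h z
  refine ContMDiffAt.contMDiffWithinAt ?_
  refine ((hQ x₀ φ).contMDiffAt ((trivializationAt F A x₀).open_baseSet.mem_nhds hz)
    |>.congr_of_eventuallyEq ?_)
  filter_upwards [hPQ] with y hy
  rw [localRep_congr hy]

theorem IsSmoothMultisection.coefDifferentiableAt {P : ∀ x, ExteriorAlgebra ℝ (A x)}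
    (hP : IsSmoothMultisection E F P) (x : M) : CoefDifferentiableAt E (localRep F x P) x :=
  fun φ => ((hP x φ).contMDiffAt (eventually_mem_baseSet x)).mdifferentiableAt (by simp)

variable [FiniteDimensional ℝ F]

theorem ofFunction_mul_apply (f : C^∞⟮𝓘(ℝ, E), M; 𝓘(ℝ, ℝ), ℝ⟯) (P : Multisection E F A) (x : M) :
    (ofFunction f * P).1 x = f x • P.1 x :=
  (Algebra.smul_def (f x) (P.1 x)).symm

theorem multisection_ext {P Q : Multisection E F A} (h : ∀ x, P.1 x = Q.1 x) : P = Q :=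
  Subtype.ext (funext h)

theorem localRep_ofFunction (x₀ : M) (f : C^∞⟮𝓘(ℝ, E), M; 𝓘(ℝ, ℝ), ℝ⟯) (y : M) :
    localRep F x₀ (ofFunction f : Multisection E F A).1 y = algebraMap ℝ _ (f y) :=
  AlgHom.commutes _ _

theorem localRep_mem {k : ℕ} {P : Multisection E F A} (hP : P ∈ multisectionDeg E F A k)
    (x₀ y : M) : localRep F x₀ P.1 y ∈ ⋀[ℝ]^k F :=
  map_mem_exteriorPower _ (hP y)

theorem ofFunction_mem (f : C^∞⟮𝓘(ℝ, E), M; 𝓘(ℝ, ℝ), ℝ⟯) :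
    (ofFunction f : Multisection E F A) ∈ multisectionDeg E F A 0 := fun x => by
  rw [ExteriorAlgebra.exteriorPower, pow_zero]
  exact Submodule.algebraMap_mem _

theorem exists_ofFunction {P : Multisection E F A} (hP : P ∈ multisectionDeg E F A 0) :
    ∃ f : C^∞⟮𝓘(ℝ, E), M; 𝓘(ℝ, ℝ), ℝ⟯, P = ofFunction f := by
  have h : ∀ x, ∃ r : ℝ, algebraMap ℝ _ r = P.1 x := fun x =>
    Submodule.mem_one.1 (by simpa using hP x)
  choose f hf using h
  have hs : ContMDiff 𝓘(ℝ, E) 𝓘(ℝ, ℝ) ∞ f := fun x => by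
    -- The scalar part is a linear functional on the exterior algebra, so smoothness of `P` gives
    -- smoothness of `f` directly.
    refine ((P.2 x (ExteriorAlgebra.algebraMapInv (R := ℝ) (M := F)).toLinearMap).contMDiffAt
      (eventually_mem_baseSet x)).congr_of_eventuallyEq (.of_forall fun y => ?_)
    change f y = ExteriorAlgebra.algebraMapInv (localRep F x P.1 y)
    rw [localRep, ← hf, AlgHom.commutes, ExteriorAlgebra.algebraMap_leftInverse]
  exact ⟨⟨f, hs⟩, multisection_ext fun x => (hf x).symm⟩

variable [ContMDiffVectorBundle ∞ F A 𝓘(ℝ, E)]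

theorem localRep_ofSection (x₀ : M) (X : Cₛ^∞⟮𝓘(ℝ, E); F, A⟯) (y : M) :
    localRep F x₀ (ofSection X : Multisection E F A).1 y =
      ExteriorAlgebra.ι ℝ ((trivializationAt F A x₀).continuousLinearMapAt ℝ y (X y)) :=
  ExteriorAlgebra.map_apply_ι _ _

theorem ofSection_mem (X : Cₛ^∞⟮𝓘(ℝ, E); F, A⟯) :
    (ofSection X : Multisection E F A) ∈ multisectionDeg E F A 1 := fun x => by
  rw [ExteriorAlgebra.exteriorPower, pow_one]
  exact ⟨X x, rfl⟩

theorem ofSection_mul_mem (X : Cₛ^∞⟮𝓘(ℝ, E); F, A⟯) {k : ℕ} {P : Multisection E F A}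
    (hP : P ∈ multisectionDeg E F A k) : ofSection X * P ∈ multisectionDeg E F A (k + 1) :=
  fun x => ι_mul_mem (hP x) (X x)

variable [FiniteDimensional ℝ E] [T2Space M] [IsManifold 𝓘(ℝ, E) ∞ M]

theorem eventually_localRep_extendConst (x : M) (v : F) :
    ∀ᶠ y in 𝓝 x, localRep F x
      (ofSection (extendConst x v : Cₛ^∞⟮𝓘(ℝ, E); F, A⟯) : Multisection E F A).1 y =
        ExteriorAlgebra.ι ℝ v := by
  filter_upwards [(exists_extendConst (E := E) (A := A) x v).choose_spec,
    eventually_mem_baseSet (F := F) (A := A) x] with y hy hb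
  rw [localRep_ofSection]
  erw [hy]
  rw [(trivializationAt F A x).continuousLinearMapAt_symmL hb]

/-- A property of multisections which only depends on the germ at `x` holds for all of them if it
is closed under sums, products with sections from the left, and holds for functions. -/
theorem multisection_induction (x : M) {p : Multisection E F A → Prop}
    (function : ∀ f, p (ofFunction f)) (section_mul : ∀ X P, p P → p (ofSection X * P))
    (add : ∀ P Q, p P → p Q → p (P + Q))
    (germ : ∀ P Q : Multisection E F A, (∀ᶠ y in 𝓝 x, P.1 y = Q.1 y) → p P → p Q)
    (P : Multisection E F A) : p P := by
  -- Each fixed `w` extends to a multisection constant near `x`. The property is carried for all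
  -- function multiples of it at once, because a general germ is a sum of such multiples.
  have hconst : ∀ w : ExteriorAlgebra ℝ F, ∃ W : Multisection E F A,
      (∀ᶠ y in 𝓝 x, localRep F x W.1 y = w) ∧ ∀ f, p (ofFunction f * W) := by
    intro w
    induction w using CliffordAlgebra.left_induction with
    | algebraMap r =>
      refine ⟨ofFunction (ContMDiffMap.const r), .of_forall fun y => localRep_ofFunction _ _ _,
        fun f => ?_⟩
      refine germ (ofFunction (f * ContMDiffMap.const r)) _ (.of_forall fun y => ?_) (function _)
      exact map_mul (algebraMap ℝ (ExteriorAlgebra ℝ (A y))) (f y) r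
    | add a b ha hb =>
      obtain ⟨Wa, ha, pa⟩ := ha
      obtain ⟨Wb, hb, pb⟩ := hb
      refine ⟨Wa + Wb, ?_, fun f => mul_add (ofFunction f) Wa Wb ▸ add _ _ (pa f) (pb f)⟩
      filter_upwards [ha, hb] with y hya hyb
      exact (localRep_add _ _ _ _).trans (congrArg₂ _ hya hyb)
    | ι_mul a v ha =>
      obtain ⟨Wa, ha, pa⟩ := ha
      refine ⟨ofSection (extendConst x v) * Wa, ?_, fun f => ?_⟩
      · filter_upwards [ha, eventually_localRep_extendConst (E := E) (A := A) x v] with y hya hyv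
        exact (localRep_mul _ _ _ _).trans (congrArg₂ _ hyv hya)
      -- The function moves past the section factor, so that the section stands leftmost as
      -- `section_mul` demands.
      · refine germ (ofSection (extendConst x v) * (ofFunction f * Wa)) _ (.of_forall fun y => ?_)
          (section_mul _ _ (pa f))
        rw [ofFunction_mul_apply]
        exact (congrArg (_ * ·) (ofFunction_mul_apply f Wa y)).trans (mul_smul_comm _ _ _)
  choose W hW pW using hconst
  -- The components of `P` are smooth only over the trivializing set; cutting them off gives global
  -- functions with the same germ at `x`.
  have hf : ∀ s, ∃ f : C^∞⟮𝓘(ℝ, E), M; 𝓘(ℝ, ℝ), ℝ⟯,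
      ∀ᶠ y in 𝓝 x, f y = (extBasis F).coord s (localRep F x P.1 y) := fun s =>
    exists_smooth_eventuallyEq (trivializationAt F A x).open_baseSet
      (FiberBundle.mem_baseSet_trivializationAt' x) (P.2 x ((extBasis F).coord s))
  choose f hf using hf
  have hsum : ∀ t : Finset (Finset (Fin (Module.finrank ℝ F))),
      p (∑ s ∈ t, ofFunction (f s) * W (extBasis F s)) := by
    intro t
    classical
    induction t using Finset.induction_on with
    | empty =>
      refine germ (ofFunction (ContMDiffMap.const 0)) _ (.of_forall fun y => ?_) (function _)
      exact map_zero (algebraMap ℝ (ExteriorAlgebra ℝ (A y)))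
    | insert s t hs ih =>
      rw [Finset.sum_insert hs]
      exact add _ _ (pW _ _) ih
  refine germ _ _ ?_ (hsum Finset.univ)
  filter_upwards [Filter.eventually_all.2 hf, Filter.eventually_all.2 fun s => hW (extBasis F s),
    eventually_mem_baseSet (F := F) (A := A) x] with y hy hWy hb
  refine eq_of_localRep_eq hb ?_
  have h1 : (∑ s, ofFunction (f s) * W (extBasis F s) : Multisection E F A).1 y =
      ∑ s, f s y • (W (extBasis F s)).1 y := by
    rw [← Finset.sum_congr rfl fun s _ => ofFunction_mul_apply (f s) (W (extBasis F s)) y]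
    simp only [AddSubmonoidClass.coe_finsetSum, Finset.sum_apply]
  rw [localRep, h1, map_sum]
  conv_rhs => rw [← (extBasis F).sum_repr (localRep F x P.1 y)]
  refine Finset.sum_congr rfl fun s _ => ?_
  rw [map_smul, hy s]
  exact congrArg _ (hWy s)

theorem exists_const_multisection (x : M) {k : ℕ} {w : ExteriorAlgebra ℝ F}
    (hw : w ∈ ⋀[ℝ]^k F) : ∃ W ∈ multisectionDeg E F A k, ∀ᶠ y in 𝓝 x, localRep F x W.1 y = w := by
  induction k generalizing w with
  | zero =>
    obtain ⟨r, rfl⟩ := Submodule.mem_one.1 (by simpa using hw)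
    exact ⟨ofFunction (ContMDiffMap.const r), ofFunction_mem _,
      .of_forall fun y => localRep_ofFunction _ _ _⟩
  | succ k ih =>
    rw [ExteriorAlgebra.exteriorPower, pow_succ'] at hw
    induction hw using Submodule.mul_induction_on' with
    | mem_mul_mem v hv b hb =>
      obtain ⟨v, rfl⟩ := hv
      obtain ⟨W, hW, h⟩ := ih hb
      refine ⟨ofSection (extendConst x v) * W, ofSection_mul_mem _ hW, ?_⟩
      filter_upwards [h, eventually_localRep_extendConst (E := E) (A := A) x v] with y hya hyv
      exact (localRep_mul _ _ _ _).trans (congrArg₂ _ hyv hya)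
    | add a _ b _ ha hb =>
      obtain ⟨Wa, ma, ha⟩ := ha
      obtain ⟨Wb, mb, hb⟩ := hb
      refine ⟨Wa + Wb, Submodule.add_mem _ ma mb, ?_⟩
      filter_upwards [ha, hb] with y hya hyb
      exact (localRep_add _ _ _ _).trans (congrArg₂ _ hya hyb)

end Germs

/-! ### Leibniz rules and locality of the Lie algebroid bracket -/

section Bracket

variable {E : Type*} [NormedAddCommGroup E] [NormedSpace ℝ E]
  {M : Type*} [TopologicalSpace M] [ChartedSpace E M]
  {F : Type*} [NormedAddCommGroup F] [NormedSpace ℝ F]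
  {A : M → Type*} [TopologicalSpace (TotalSpace F A)] [∀ x, TopologicalSpace (A x)]
  [∀ x, AddCommGroup (A x)] [∀ x, Module ℝ (A x)] [FiberBundle F A] [VectorBundle ℝ F A]

theorem section_sum_apply {ι : Type*} (t : Finset ι) (X : ι → Cₛ^∞⟮𝓘(ℝ, E); F, A⟯) (x : M) :
    (∑ i ∈ t, X i) x = ∑ i ∈ t, X i x := by
  have h := map_sum (ContMDiffSection.coeAddHom 𝓘(ℝ, E) F ∞ A) X t
  exact (congrFun h x).trans (Finset.sum_apply _ _ _)

theorem section_smul_apply (f : C^∞⟮𝓘(ℝ, E), M; 𝓘(ℝ, ℝ), ℝ⟯) (X : Cₛ^∞⟮𝓘(ℝ, E); F, A⟯) (x : M) :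
    (f • X) x = f x • X x := rfl

theorem schoutenSymbol_ι_ι {R V I : Type*} [CommRing R] [AddCommGroup V] [Module R V] [Fintype I]
    (d : I → Module.Dual R V) (e : I → I → V) (v w : V) (dv dw : I → V) :
    schoutenSymbol d (fun i j => ExteriorAlgebra.ι R (e i j)) (ExteriorAlgebra.ι R v)
        (fun i => ExteriorAlgebra.ι R (dv i)) (ExteriorAlgebra.ι R w)
        (fun i => ExteriorAlgebra.ι R (dw i)) =
      ExteriorAlgebra.ι R (∑ i, (d i v • dw i - d i w • dv i)
        + ∑ i, ∑ j, (d i v * d j w) • e i j) := by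
  simp only [schoutenSymbol, CliffordAlgebra.contractRight_ι, CliffordAlgebra.contractLeft_ι,
    ← Algebra.smul_def, ← Algebra.commutes, map_add, map_sum, map_sub, map_smul, smul_smul,
    mul_comm]

variable [IsManifold 𝓘(ℝ, E) ∞ M]

namespace LieAlgebroid

variable (L : LieAlgebroid E F A)

/-- The derivative `a(X) f` of a smooth function along the anchor of a section. -/
def anchorDeriv (X : Cₛ^∞⟮𝓘(ℝ, E); F, A⟯) (f : C^∞⟮𝓘(ℝ, E), M; 𝓘(ℝ, ℝ), ℝ⟯) :
    C^∞⟮𝓘(ℝ, E), M; 𝓘(ℝ, ℝ), ℝ⟯ :=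
  ⟨vfDeriv E (fun y => L.anchor y (X y)) f, by
    -- The derivative is the fibre component of the tangent map of `f` applied to the smooth vector
    -- field a(X).
    have h := ((f.contMDiff).contMDiff_tangentMap (m := ∞) (by simp)).comp
      (L.contMDiff_anchor.comp X.contMDiff)
    exact (contMDiff_snd_tangentBundle_modelSpace ℝ 𝓘(ℝ, ℝ)).comp h⟩

theorem anchorDeriv_apply (X : Cₛ^∞⟮𝓘(ℝ, E); F, A⟯) (f : C^∞⟮𝓘(ℝ, E), M; 𝓘(ℝ, ℝ), ℝ⟯) (x : M) :
    L.anchorDeriv X f x = dirDeriv (L.anchor x (X x)) f := rfl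

theorem anchorDeriv_const (X : Cₛ^∞⟮𝓘(ℝ, E); F, A⟯) (r : ℝ) (x : M) :
    L.anchorDeriv X (ContMDiffMap.const r) x = 0 :=
  dirDeriv_const _ _

theorem bracket_skew (X Y : Cₛ^∞⟮𝓘(ℝ, E); F, A⟯) : L.bracket X Y = -L.bracket Y X := by
  have h := L.bracket_self (X + Y)
  simp only [map_add, LinearMap.add_apply, L.bracket_self, zero_add, add_zero] at h
  exact eq_neg_of_add_eq_zero_left ((add_comm _ _).trans h)

theorem bracket_smul_smul (X Y : Cₛ^∞⟮𝓘(ℝ, E); F, A⟯) (f g : C^∞⟮𝓘(ℝ, E), M; 𝓘(ℝ, ℝ), ℝ⟯) (x : M) :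
    L.bracket (f • X) (g • Y) x = (f x * g x) • L.bracket X Y x
      + (f x * L.anchorDeriv X g x) • Y x - (g x * L.anchorDeriv Y f x) • X x := by
  rw [L.leibniz, L.bracket_skew (f • X) Y]
  have h : (-L.bracket Y (f • X)) x = f x • L.bracket X Y x - L.anchorDeriv Y f x • X x := by
    rw [L.bracket_skew X Y]
    change -(L.bracket Y (f • X) x) = f x • -(L.bracket Y X x) - _
    rw [L.leibniz, smul_neg, neg_add, sub_eq_add_neg]
    rfl
  have h' : vfDeriv E (fun y => L.anchor y ((f • X) y)) g x = f x * L.anchorDeriv X g x := by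
    change dirDeriv (L.anchor x (f x • X x)) g = _
    rw [map_smul]
    exact map_smul (mfderiv 𝓘(ℝ, E) 𝓘(ℝ, ℝ) g x) _ _
  rw [h, h', smul_sub, smul_smul, smul_smul, mul_comm (g x) (f x)]
  abel

variable [FiniteDimensional ℝ E] [T2Space M]

theorem exists_cutoff_smul_eq_zero {x : M} {X : Cₛ^∞⟮𝓘(ℝ, E); F, A⟯} (hX : ∀ᶠ y in 𝓝 x, X y = 0) :
    ∃ χ : C^∞⟮𝓘(ℝ, E), M; 𝓘(ℝ, ℝ), ℝ⟯, (∀ᶠ y in 𝓝 x, χ y = 1) ∧ χ • X = 0 := by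
  obtain ⟨χ, h1, hχ⟩ := exists_cutoff (E := E) hX
  refine ⟨χ, h1, ContMDiffSection.ext fun y => ?_⟩
  rw [section_smul_apply]
  by_cases hy : y ∈ tsupport χ
  · rw [hχ hy, smul_zero]; rfl
  · rw [image_eq_zero_of_notMem_tsupport hy, zero_smul]; rfl

/-- Apply the Leibniz rule to χY = 0 with χ = 1 near `x`: the anchor term contains Y(x) = 0, and
what remains is the bracket. -/
theorem bracket_apply_eq_zero {x : M} (X : Cₛ^∞⟮𝓘(ℝ, E); F, A⟯) {Y : Cₛ^∞⟮𝓘(ℝ, E); F, A⟯}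
    (hY : ∀ᶠ y in 𝓝 x, Y y = 0) : L.bracket X Y x = 0 := by
  obtain ⟨χ, h1, hχ⟩ := exists_cutoff_smul_eq_zero hY
  have h := L.leibniz X Y χ x
  rw [hχ, map_zero, h1.self_of_nhds, hY.self_of_nhds, smul_zero, add_zero, one_smul] at h
  exact h.symm

theorem bracket_congr {x : M} {X X' Y Y' : Cₛ^∞⟮𝓘(ℝ, E); F, A⟯}
    (hX : ∀ᶠ y in 𝓝 x, X y = X' y) (hY : ∀ᶠ y in 𝓝 x, Y y = Y' y) :
    L.bracket X Y x = L.bracket X' Y' x := by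
  have h1 : L.bracket X (Y - Y') x = 0 :=
    L.bracket_apply_eq_zero X (hY.mono fun y hy => sub_eq_zero.2 hy)
  have h2 : L.bracket Y' (X - X') x = 0 :=
    L.bracket_apply_eq_zero Y' (hX.mono fun y hy => sub_eq_zero.2 hy)
  rw [map_sub] at h1 h2
  rw [sub_eq_zero.1 h1, L.bracket_skew X Y', L.bracket_skew X' Y']
  exact congrArg Neg.neg (sub_eq_zero.1 h2)

variable [FiniteDimensional ℝ F] [ContMDiffVectorBundle ∞ F A 𝓘(ℝ, E)]

theorem exists_frame_expansion (x : M) (X : Cₛ^∞⟮𝓘(ℝ, E); F, A⟯) :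
    ∃ f : Fin (Module.finrank ℝ F) → C^∞⟮𝓘(ℝ, E), M; 𝓘(ℝ, ℝ), ℝ⟯,
      (∀ i, ∀ᶠ y in 𝓝 x, f i y = (Module.finBasis ℝ F).coord i
        ((trivializationAt F A x).continuousLinearMapAt ℝ y (X y))) ∧
      ∀ᶠ y in 𝓝 x, X y = (∑ i, f i • (frame x i : Cₛ^∞⟮𝓘(ℝ, E); F, A⟯)) y := by
  have hf : ∀ i, ∃ g : C^∞⟮𝓘(ℝ, E), M; 𝓘(ℝ, ℝ), ℝ⟯, ∀ᶠ y in 𝓝 x, g y =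
      (Module.finBasis ℝ F).coord i
        ((trivializationAt F A x).continuousLinearMapAt ℝ y (X y)) := fun i => by
    refine exists_smooth_eventuallyEq (trivializationAt F A x).open_baseSet
      (FiberBundle.mem_baseSet_trivializationAt' x) ?_
    -- A coordinate of `X` is a functional of its image in the exterior algebra, hence smooth by the
    -- definition of a multisection.
    refine ((ofSection X : Multisection E F A).2 x
      ((Module.finBasis ℝ F).coord i ∘ₗ ExteriorAlgebra.ιInv)).congr fun y _ => ?_
    rw [localRep_ofSection, LinearMap.comp_apply, ExteriorAlgebra.ι_leftInverse]
  choose f hf using hf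
  refine ⟨f, hf, ?_⟩
  filter_upwards [Filter.eventually_all.2 hf, eventually_mem_baseSet (F := F) (A := A) x,
    Filter.eventually_all.2 fun i => (exists_extendConst (E := E) (A := A) x
      (Module.finBasis ℝ F i)).choose_spec] with y hy hb hfr
  have hfr' : ∀ i, (frame x i : Cₛ^∞⟮𝓘(ℝ, E); F, A⟯) y =
    (trivializationAt F A x).symmL ℝ y (Module.finBasis ℝ F i) := hfr
  rw [section_sum_apply]
  simp only [section_smul_apply, hfr', hy, ← map_smul, ← map_sum, Module.Basis.coord_apply]
  rw [Module.Basis.sum_repr, (trivializationAt F A x).symmL_continuousLinearMapAt hb]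

end LieAlgebroid

end Bracket

/-! ### The Schouten bracket with a section: product rule and values on generators -/

section Schouten

variable {E : Type*} [NormedAddCommGroup E] [NormedSpace ℝ E]
  {M : Type*} [TopologicalSpace M] [ChartedSpace E M]
  {F : Type*} [NormedAddCommGroup F] [NormedSpace ℝ F]
  {A : M → Type*} [TopologicalSpace (TotalSpace F A)] [∀ x, TopologicalSpace (A x)]
  [∀ x, AddCommGroup (A x)] [∀ x, Module ℝ (A x)] [FiberBundle F A] [VectorBundle ℝ F A]
  [IsManifold 𝓘(ℝ, E) ∞ M] [FiniteDimensional ℝ E] [T2Space M]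
  [FiniteDimensional ℝ F] [ContMDiffVectorBundle ∞ F A 𝓘(ℝ, E)]

namespace LieAlgebroid

variable (L : LieAlgebroid E F A)

theorem frame_apply_self (x : M) (i : Fin (Module.finrank ℝ F)) :
    (frame x i : Cₛ^∞⟮𝓘(ℝ, E); F, A⟯) x =
      (trivializationAt F A x).symmL ℝ x (Module.finBasis ℝ F i) :=
  (exists_extendConst (E := E) (A := A) x (Module.finBasis ℝ F i)).choose_spec.self_of_nhds

/-- The coordinates at `x` of the bracket of two sections of the frame at `x`. -/
def frameBracket (x : M) (i j : Fin (Module.finrank ℝ F)) : F :=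
  (trivializationAt F A x).continuousLinearMapAt ℝ x (L.bracket (frame x i) (frame x j) x)

theorem frameBracket_skew (x : M) (i j : Fin (Module.finrank ℝ F)) :
    L.frameBracket x i j = -L.frameBracket x j i := by
  rw [frameBracket, L.bracket_skew]
  exact map_neg _ _

theorem frameDeriv_eq (x : M) (i : Fin (Module.finrank ℝ F)) (P : ∀ x, ExteriorAlgebra ℝ (A x)) :
    L.frameDeriv x i P =
      coefDeriv (L.anchor x ((frame x i : Cₛ^∞⟮𝓘(ℝ, E); F, A⟯) x)) (localRep F x P) := rfl

theorem frameDeriv_congr {x : M} (i : Fin (Module.finrank ℝ F))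
    {P Q : ∀ x, ExteriorAlgebra ℝ (A x)} (h : ∀ᶠ y in 𝓝 x, P y = Q y) :
    L.frameDeriv x i P = L.frameDeriv x i Q :=
  coefDeriv_congr _ (h.mono fun _ hy => localRep_congr hy)

theorem frameDeriv_add (x : M) (i : Fin (Module.finrank ℝ F)) (P Q : Multisection E F A) :
    L.frameDeriv x i (P + Q).1 = L.frameDeriv x i P.1 + L.frameDeriv x i Q.1 := by
  simp only [frameDeriv_eq]
  rw [← coefDeriv_add _ (P.2.coefDifferentiableAt x) (Q.2.coefDifferentiableAt x)]
  exact congrArg _ (funext fun y => localRep_add _ _ _ _)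

theorem frameDeriv_mul (x : M) (i : Fin (Module.finrank ℝ F)) (P Q : Multisection E F A) :
    L.frameDeriv x i (P * Q).1 =
      L.frameDeriv x i P.1 * localRep F x Q.1 x + localRep F x P.1 x * L.frameDeriv x i Q.1 := by
  simp only [frameDeriv_eq]
  rw [← coefDeriv_mul _ (P.2.coefDifferentiableAt x) (Q.2.coefDifferentiableAt x)]
  exact congrArg _ (funext fun y => localRep_mul _ _ _ _)

theorem frameDeriv_ofFunction (x : M) (i : Fin (Module.finrank ℝ F))
    (f : C^∞⟮𝓘(ℝ, E), M; 𝓘(ℝ, ℝ), ℝ⟯) :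
    L.frameDeriv x i (ofFunction f : Multisection E F A).1 =
      algebraMap ℝ _ (L.anchorDeriv (frame x i) f x) := by
  rw [frameDeriv_eq, anchorDeriv_apply, ← coefDeriv_algebraMap _
    (f.contMDiff.contMDiffAt.mdifferentiableAt (by simp))]
  exact congrArg _ (funext fun y => localRep_ofFunction _ _ _)

theorem frameDeriv_mem (x : M) (i : Fin (Module.finrank ℝ F)) {k : ℕ} {P : Multisection E F A}
    (hP : P ∈ multisectionDeg E F A k) : L.frameDeriv x i P.1 ∈ ⋀[ℝ]^k F :=
  coefDeriv_mem _ (P.2.coefDifferentiableAt x) (.of_forall fun y => localRep_mem hP x y)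

/-- The derivative of the coordinates of a section along the frame at `x`. -/
def sectionDeriv (x : M) (i : Fin (Module.finrank ℝ F)) (X : Cₛ^∞⟮𝓘(ℝ, E); F, A⟯) : F :=
  ExteriorAlgebra.ιInv (L.frameDeriv x i (ofSection X : Multisection E F A).1)

theorem frameDeriv_ofSection (x : M) (i : Fin (Module.finrank ℝ F)) (X : Cₛ^∞⟮𝓘(ℝ, E); F, A⟯) :
    L.frameDeriv x i (ofSection X : Multisection E F A).1 =
      ExteriorAlgebra.ι ℝ (L.sectionDeriv x i X) := by
  obtain ⟨v, hv⟩ := mem_exteriorPower_one (L.frameDeriv_mem x i (ofSection_mem X))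
  rw [sectionDeriv, hv, ExteriorAlgebra.ι_leftInverse]

theorem coord_sectionDeriv (x : M) (i j : Fin (Module.finrank ℝ F)) (X : Cₛ^∞⟮𝓘(ℝ, E); F, A⟯)
    {f : C^∞⟮𝓘(ℝ, E), M; 𝓘(ℝ, ℝ), ℝ⟯} (hf : ∀ᶠ y in 𝓝 x, f y = (Module.finBasis ℝ F).coord j
        ((trivializationAt F A x).continuousLinearMapAt ℝ y (X y))) :
    (Module.finBasis ℝ F).coord j (L.sectionDeriv x i X) = L.anchorDeriv (frame x i) f x := by
  rw [sectionDeriv, ← LinearMap.comp_apply, frameDeriv_eq,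
    dual_coefDeriv _ ((ofSection X : Multisection E F A).2.coefDifferentiableAt x),
    anchorDeriv_apply]
  refine dirDeriv_congr _ (hf.mono fun y hy => ?_)
  beta_reduce
  rw [hy, localRep_ofSection, LinearMap.comp_apply, ExteriorAlgebra.ι_leftInverse]

variable (F) in
/-- The dual coframe. -/
abbrev coframe (i : Fin (Module.finrank ℝ F)) : Module.Dual ℝ F := (Module.finBasis ℝ F).coord i

/-- This separates analysis from algebra: once the values and frame derivatives at `x` are fixed,
every identity for the bracket is one for `schoutenSymbol`. -/
theorem schouten_eq (P Q : Multisection E F A) (x : M) :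
    L.schouten P Q x = ExteriorAlgebra.map ((trivializationAt F A x).symmL ℝ x : F →ₗ[ℝ] A x)
      (schoutenSymbol (coframe F) (fun i j => ExteriorAlgebra.ι ℝ (L.frameBracket x i j))
        (localRep F x P.1 x) (fun i => L.frameDeriv x i P.1)
        (localRep F x Q.1 x) (fun i => L.frameDeriv x i Q.1)) := by
  simp only [frameBracket, ← localRep_ofSection]
  rfl

theorem schouten_congr {x : M} {P P' Q Q' : Multisection E F A}
    (hP : ∀ᶠ y in 𝓝 x, P.1 y = P'.1 y) (hQ : ∀ᶠ y in 𝓝 x, Q.1 y = Q'.1 y) :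
    L.schouten P Q x = L.schouten P' Q' x := by
  simp only [schouten_eq, L.frameDeriv_congr _ hP, L.frameDeriv_congr _ hQ,
    localRep_congr (F := F) (x₀ := x) hP.self_of_nhds, localRep_congr (F := F) (x₀ := x) hQ.self_of_nhds]

theorem schouten_add_left (P P' Q : Multisection E F A) (x : M) :
    L.schouten (P + P') Q x = L.schouten P Q x + L.schouten P' Q x := by
  have h : localRep F x (P + P').1 x = _ := localRep_add x P.1 P'.1 x
  rw [schouten_eq, schouten_eq, schouten_eq, ← map_add, h]
  congr 1
  simp only [schoutenSymbol, frameDeriv_add, map_add, LinearMap.add_apply, add_mul,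
    Finset.sum_add_distrib, Finset.sum_sub_distrib]
  abel

theorem schouten_add_right (P Q Q' : Multisection E F A) (x : M) :
    L.schouten P (Q + Q') x = L.schouten P Q x + L.schouten P Q' x := by
  have h : localRep F x (Q + Q').1 x = _ := localRep_add x Q.1 Q'.1 x
  rw [schouten_eq, schouten_eq, schouten_eq, ← map_add, h]
  congr 1
  simp only [schoutenSymbol, frameDeriv_add, map_add, mul_add,
    Finset.sum_add_distrib, Finset.sum_sub_distrib]
  abel

theorem lieDeriv_mul (X : Cₛ^∞⟮𝓘(ℝ, E); F, A⟯) (P Q : Multisection E F A) (x : M) :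
    L.lieDeriv X (P * Q) x = L.lieDeriv X P x * Q.1 x + P.1 x * L.lieDeriv X Q x := by
  have h : localRep F x (P * Q).1 x = _ := localRep_mul x P.1 Q.1 x
  rw [lieDeriv, lieDeriv, lieDeriv, schouten_eq, schouten_eq, schouten_eq, h, localRep_ofSection]
  simp only [frameDeriv_mul, frameDeriv_ofSection, schoutenSymbol_ι_mul, map_add, map_mul,
    map_symmL_localRep (FiberBundle.mem_baseSet_trivializationAt' x)]

theorem section_apply_eq_sum (x : M) (X : Cₛ^∞⟮𝓘(ℝ, E); F, A⟯) :
    X x = ∑ i, coframe F i ((trivializationAt F A x).continuousLinearMapAt ℝ x (X x)) •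
      (frame x i : Cₛ^∞⟮𝓘(ℝ, E); F, A⟯) x := by
  simp only [frame_apply_self, ← map_smul, ← map_sum, coframe, Module.Basis.coord_apply]
  rw [Module.Basis.sum_repr, (trivializationAt F A x).symmL_continuousLinearMapAt (FiberBundle.mem_baseSet_trivializationAt' x)]

theorem anchorDeriv_eq_sum (X : Cₛ^∞⟮𝓘(ℝ, E); F, A⟯) (f : C^∞⟮𝓘(ℝ, E), M; 𝓘(ℝ, ℝ), ℝ⟯) (x : M) :
    L.anchorDeriv X f x = ∑ i,
      coframe F i ((trivializationAt F A x).continuousLinearMapAt ℝ x (X x)) *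
        L.anchorDeriv (frame x i) f x := by
  simp only [anchorDeriv_apply]
  conv_lhs => rw [section_apply_eq_sum x X]
  simp only [dirDeriv, map_sum, map_smul]
  rfl

theorem lieDeriv_ofFunction (X : Cₛ^∞⟮𝓘(ℝ, E); F, A⟯) (f : C^∞⟮𝓘(ℝ, E), M; 𝓘(ℝ, ℝ), ℝ⟯) (x : M) :
    L.lieDeriv X (ofFunction f) x = algebraMap ℝ _ (L.anchorDeriv X f x) := by
  rw [lieDeriv, schouten_eq, localRep_ofSection, localRep_ofFunction, anchorDeriv_eq_sum]
  simp only [frameDeriv_ofSection, frameDeriv_ofFunction, schoutenSymbol,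
    CliffordAlgebra.contractLeft_algebraMap, CliffordAlgebra.contractRight_ι, mul_zero, sub_zero,
    Finset.sum_const_zero, add_zero, map_sum, ← map_mul, AlgHom.commutes]

/-- Near `x` both sections are combinations of the frame, and the algebroid bracket sees only germs.
Expanding it by the two-sided Leibniz rule produces exactly the degree-one frame formula. -/
theorem lieDeriv_ofSection (X Y : Cₛ^∞⟮𝓘(ℝ, E); F, A⟯) (x : M) :
    L.lieDeriv X (ofSection Y) x = ExteriorAlgebra.ι ℝ (L.bracket X Y x) := by
  obtain ⟨f, hf, hX⟩ := exists_frame_expansion x X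
  obtain ⟨g, hg, hY⟩ := exists_frame_expansion x Y
  have expand : ∀ v : F, v = ∑ j, coframe F j v • Module.finBasis ℝ F j := fun v =>
    ((Module.finBasis ℝ F).sum_repr v).symm
  have hbr : ∀ i j, (trivializationAt F A x).symmL ℝ x (L.frameBracket x i j) =
      L.bracket (frame x i) (frame x j) x := fun i j =>
    (trivializationAt F A x).symmL_continuousLinearMapAt (FiberBundle.mem_baseSet_trivializationAt' x) _
  have hdX : ∀ i, (trivializationAt F A x).symmL ℝ x (L.sectionDeriv x i X) =
      ∑ j, L.anchorDeriv (frame x i) (f j) x • (frame x j : Cₛ^∞⟮𝓘(ℝ, E); F, A⟯) x := fun i => by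
    rw [expand (L.sectionDeriv x i X), map_sum]
    exact Finset.sum_congr rfl fun j _ => by
      rw [map_smul, L.coord_sectionDeriv x i j X (hf j), frame_apply_self]
  have hdY : ∀ i, (trivializationAt F A x).symmL ℝ x (L.sectionDeriv x i Y) =
      ∑ j, L.anchorDeriv (frame x i) (g j) x • (frame x j : Cₛ^∞⟮𝓘(ℝ, E); F, A⟯) x := fun i => by
    rw [expand (L.sectionDeriv x i Y), map_sum]
    exact Finset.sum_congr rfl fun j _ => by
      rw [map_smul, L.coord_sectionDeriv x i j Y (hg j), frame_apply_self]
  rw [lieDeriv, schouten_eq, localRep_ofSection, localRep_ofSection]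
  simp only [frameDeriv_ofSection, schoutenSymbol_ι_ι, ExteriorAlgebra.map_apply_ι]
  congr 1
  have hsum : L.bracket (∑ i, f i • (frame x i : Cₛ^∞⟮𝓘(ℝ, E); F, A⟯))
      (∑ i, g i • (frame x i : Cₛ^∞⟮𝓘(ℝ, E); F, A⟯)) x =
      ∑ i, ∑ j, L.bracket (f i • frame x i) (g j • frame x j) x := by
    rw [map_sum L.bracket, LinearMap.sum_apply, section_sum_apply]
    refine Finset.sum_congr rfl fun i _ => ?_
    rw [map_sum (L.bracket (f i • frame x i)), section_sum_apply]
  rw [L.bracket_congr hX hY, hsum]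
  simp only [bracket_smul_smul, ContinuousLinearMap.coe_coe, map_add, map_sum,
    map_sub, map_smul, hdX, hdY, hbr, ← (hf _).self_of_nhds, ← (hg _).self_of_nhds,
    Finset.smul_sum, smul_smul, Finset.sum_add_distrib, Finset.sum_sub_distrib]
  -- In the Leibniz expansion the terms that differentiate `f` have the roles of the two indices
  -- exchanged.
  rw [Finset.sum_comm (f := fun i j => (g j x * L.anchorDeriv (frame x j) (f i) x) • _)]
  abel

/-- The right contraction of a section is a scalar, and every left contraction of `P` is multiplied
by a vector, so no term changes the degree. -/
theorem lieDeriv_mem (X : Cₛ^∞⟮𝓘(ℝ, E); F, A⟯) {k : ℕ} {P : Multisection E F A}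
    (hP : P ∈ multisectionDeg E F A k) (x : M) : L.lieDeriv X P x ∈ ⋀[ℝ]^k (A x) := by
  rw [lieDeriv, schouten_eq]
  refine map_mem_exteriorPower _ ?_
  rw [localRep_ofSection]
  simp only [frameDeriv_ofSection, schoutenSymbol, CliffordAlgebra.contractRight_ι,
    ← Algebra.smul_def, smul_mul_assoc]
  exact Submodule.add_mem _
    (Submodule.sum_mem _ fun i _ => Submodule.sub_mem _
      (Submodule.smul_mem _ _ (L.frameDeriv_mem x i hP))
      (ι_mul_contractLeft_mem (localRep_mem hP x x) _ _))
    (Submodule.sum_mem _ fun i _ => Submodule.sum_mem _ fun j _ => Submodule.smul_mem _ _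
      (ι_mul_contractLeft_mem (localRep_mem hP x x) _ _))

end LieAlgebroid

end Schouten

/-! ### Local operators and the Lie derivative as a representation -/

section LocalOperators

variable {E : Type*} [NormedAddCommGroup E] [NormedSpace ℝ E]
  {M : Type*} [TopologicalSpace M] [ChartedSpace E M]
  {F : Type*} [NormedAddCommGroup F] [NormedSpace ℝ F]
  {A : M → Type*} [TopologicalSpace (TotalSpace F A)] [∀ x, TopologicalSpace (A x)]
  [∀ x, AddCommGroup (A x)] [∀ x, Module ℝ (A x)] [FiberBundle F A] [VectorBundle ℝ F A]
  [FiniteDimensional ℝ F]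

theorem ofFunction_comm (f : C^∞⟮𝓘(ℝ, E), M; 𝓘(ℝ, ℝ), ℝ⟯) (P : Multisection E F A) :
    ofFunction f * P = P * ofFunction f :=
  multisection_ext fun x => Algebra.commutes (f x) (P.1 x)

theorem ofFunction_mul_add_apply (f g : C^∞⟮𝓘(ℝ, E), M; 𝓘(ℝ, ℝ), ℝ⟯) (P Q : Multisection E F A)
    (x : M) : (ofFunction f * P + ofFunction g * Q).1 x = f x • P.1 x + g x • Q.1 x := by
  rw [← ofFunction_mul_apply, ← ofFunction_mul_apply]
  rfl

theorem ofFunction_const_mul (r : ℝ) (P : Multisection E F A) :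
    ofFunction (ContMDiffMap.const r) * P = r • P :=
  multisection_ext fun _ => ofFunction_mul_apply _ _ _

theorem ofFunction_add (f g : C^∞⟮𝓘(ℝ, E), M; 𝓘(ℝ, ℝ), ℝ⟯) :
    (ofFunction (f + g) : Multisection E F A) = ofFunction f + ofFunction g :=
  multisection_ext fun x => map_add (algebraMap ℝ (ExteriorAlgebra ℝ (A x))) (f x) (g x)

theorem ofFunction_mul (f g : C^∞⟮𝓘(ℝ, E), M; 𝓘(ℝ, ℝ), ℝ⟯) :
    (ofFunction (f * g) : Multisection E F A) = ofFunction f * ofFunction g :=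
  multisection_ext fun x => map_mul (algebraMap ℝ (ExteriorAlgebra ℝ (A x))) (f x) (g x)

theorem ofFunction_sub (f g : C^∞⟮𝓘(ℝ, E), M; 𝓘(ℝ, ℝ), ℝ⟯) :
    (ofFunction (f - g) : Multisection E F A) = ofFunction f - ofFunction g :=
  multisection_ext fun x => map_sub (algebraMap ℝ (ExteriorAlgebra ℝ (A x))) (f x) (g x)

theorem ofFunction_injective :
    Function.Injective (ofFunction : C^∞⟮𝓘(ℝ, E), M; 𝓘(ℝ, ℝ), ℝ⟯ → Multisection E F A) :=
  fun _ _ h => ContMDiffMap.ext fun x => (ExteriorAlgebra.algebraMap_inj (A x) _ _).1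
    (congrFun (congrArg Subtype.val h) x)

/-- An operator on multisections is local if it does not increase supports. -/
def IsLocalOperator (T : Multisection E F A →ₗ[ℝ] Multisection E F A) : Prop :=
  ∀ (x : M) (P : Multisection E F A), (∀ᶠ y in 𝓝 x, P.1 y = 0) → (T P).1 x = 0

theorem IsLocalOperator.comp {S T : Multisection E F A →ₗ[ℝ] Multisection E F A}
    (hS : IsLocalOperator S) (hT : IsLocalOperator T) : IsLocalOperator (S ∘ₗ T) :=
  fun x P hP => hS x (T P) (hP.eventually_nhds.mono fun y hy => hT y P hy)

theorem IsLocalOperator.sub {S T : Multisection E F A →ₗ[ℝ] Multisection E F A}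
    (hS : IsLocalOperator S) (hT : IsLocalOperator T) : IsLocalOperator (S - T) :=
  fun x P hP => by
    change (S P).1 x - (T P).1 x = 0
    rw [hS x P hP, hT x P hP, sub_zero]

theorem isLocalOperator_mulLeft (Q : Multisection E F A) :
    IsLocalOperator (LinearMap.mulLeft ℝ Q) := fun x P hP => by
  change Q.1 x * P.1 x = 0
  rw [hP.self_of_nhds, mul_zero]

variable [ContMDiffVectorBundle ∞ F A 𝓘(ℝ, E)]

theorem ofSection_add (X Y : Cₛ^∞⟮𝓘(ℝ, E); F, A⟯) :
    (ofSection (X + Y) : Multisection E F A) = ofSection X + ofSection Y :=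
  multisection_ext fun x => map_add (ExteriorAlgebra.ι ℝ) (X x) (Y x)

theorem ofSection_smul (f : C^∞⟮𝓘(ℝ, E), M; 𝓘(ℝ, ℝ), ℝ⟯) (X : Cₛ^∞⟮𝓘(ℝ, E); F, A⟯) :
    (ofSection (f • X) : Multisection E F A) = ofFunction f * ofSection X :=
  multisection_ext fun x => by
    rw [ofFunction_mul_apply]
    exact map_smul (ExteriorAlgebra.ι ℝ) (f x) (X x)

theorem ofSection_real_smul (r : ℝ) (X : Cₛ^∞⟮𝓘(ℝ, E); F, A⟯) :
    (ofSection (r • X) : Multisection E F A) = r • ofSection X :=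
  multisection_ext fun x => map_smul (ExteriorAlgebra.ι ℝ) r (X x)

variable [IsManifold 𝓘(ℝ, E) ∞ M] [FiniteDimensional ℝ E] [T2Space M]

/-- A local operator vanishes as soon as it vanishes on functions and its zeros at each point are
stable under multiplication with sections. -/
theorem IsLocalOperator.eq_zero {T : Multisection E F A →ₗ[ℝ] Multisection E F A}
    (hT : IsLocalOperator T) (function : ∀ f, T (ofFunction f) = 0)
    (section_mul : ∀ X P x, (T P).1 x = 0 → (T (ofSection X * P)).1 x = 0) : T = 0 := by
  refine LinearMap.ext fun P => multisection_ext fun x => ?_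
  refine multisection_induction x (p := fun P => (T P).1 x = 0) (fun f => ?_)
    (fun X P => section_mul X P x) (fun P Q hP hQ => ?_) (fun P Q hPQ hP => ?_) P
  · rw [function]; rfl
  · rw [map_add]
    change (T P).1 x + (T Q).1 x = 0
    rw [hP, hQ, add_zero]
  · have h := hT x (P - Q) (hPQ.mono fun y hy => sub_eq_zero.2 hy)
    rw [map_sub] at h
    exact (sub_eq_zero.1 h).symm.trans hP

namespace LieAlgebroid

variable (L : LieAlgebroid E F A)

/-- The frame in the pointwise formula varies with the point, so smoothness cannot be read off from
it. It is obtained by induction on germs from the values on functions and sections and the product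
rule. -/
theorem isSmoothMultisection_lieDeriv (X : Cₛ^∞⟮𝓘(ℝ, E); F, A⟯) (P : Multisection E F A) :
    IsSmoothMultisection E F (L.lieDeriv X P) := by
  refine .of_eventuallyEq fun z => ?_
  refine multisection_induction z (p := fun P => ∃ Q, IsSmoothMultisection E F Q ∧
    ∀ᶠ y in 𝓝 z, L.lieDeriv X P y = Q y) (fun f => ?_) (fun Y P hP => ?_)
    (fun P P' hP hP' => ?_) (fun P P' h hP => ?_) P
  · exact ⟨_, (ofFunction (L.anchorDeriv X f)).2,
      .of_forall fun y => L.lieDeriv_ofFunction X f y⟩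
  · obtain ⟨Q, hQ, hPQ⟩ := hP
    refine ⟨_, (ofSection (L.bracket X Y) * P + ofSection Y * ⟨Q, hQ⟩ : Multisection E F A).2, ?_⟩
    filter_upwards [hPQ] with y hy
    rw [lieDeriv_mul, lieDeriv_ofSection, hy]
    rfl
  · obtain ⟨Q, hQ, hPQ⟩ := hP
    obtain ⟨Q', hQ', hPQ'⟩ := hP'
    refine ⟨_, (⟨Q, hQ⟩ + ⟨Q', hQ'⟩ : Multisection E F A).2, ?_⟩
    filter_upwards [hPQ, hPQ'] with y hy hy'
    rw [lieDeriv, schouten_add_right]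
    exact congrArg₂ _ hy hy'
  · obtain ⟨Q, hQ, hPQ⟩ := hP
    refine ⟨Q, hQ, ?_⟩
    filter_upwards [hPQ, h.eventually_nhds] with y hy hy'
    rw [← hy]
    exact (L.schouten_congr (.of_forall fun _ => rfl) hy').symm

/-- The Lie derivative as an operator on multisections. -/
def lieOperator (X : Cₛ^∞⟮𝓘(ℝ, E); F, A⟯) : Multisection E F A →ₗ[ℝ] Multisection E F A where
  toFun P := ⟨L.lieDeriv X P, L.isSmoothMultisection_lieDeriv X P⟩
  map_add' P Q := multisection_ext fun x => L.schouten_add_right _ P Q x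
  map_smul' r P := multisection_ext fun x => by
    change L.lieDeriv X (r • P) x = r • L.lieDeriv X P x
    rw [← ofFunction_const_mul, lieDeriv_mul, lieDeriv_ofFunction, anchorDeriv_const, map_zero,
      zero_mul, zero_add]
    exact (Algebra.smul_def _ _).symm

theorem lieOperator_apply (X : Cₛ^∞⟮𝓘(ℝ, E); F, A⟯) (P : Multisection E F A) (x : M) :
    (L.lieOperator X P).1 x = L.lieDeriv X P x := rfl

theorem lieOperator_mul (X : Cₛ^∞⟮𝓘(ℝ, E); F, A⟯) (P Q : Multisection E F A) :
    L.lieOperator X (P * Q) = L.lieOperator X P * Q + P * L.lieOperator X Q :=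
  multisection_ext fun x => L.lieDeriv_mul X P Q x

theorem lieOperator_ofFunction (X : Cₛ^∞⟮𝓘(ℝ, E); F, A⟯) (f : C^∞⟮𝓘(ℝ, E), M; 𝓘(ℝ, ℝ), ℝ⟯) :
    L.lieOperator X (ofFunction f) = ofFunction (L.anchorDeriv X f) :=
  multisection_ext fun x => L.lieDeriv_ofFunction X f x

theorem lieOperator_ofSection (X Y : Cₛ^∞⟮𝓘(ℝ, E); F, A⟯) :
    L.lieOperator X (ofSection Y) = ofSection (L.bracket X Y) :=
  multisection_ext fun x => L.lieDeriv_ofSection X Y x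

theorem lieOperator_mem (X : Cₛ^∞⟮𝓘(ℝ, E); F, A⟯) {k : ℕ} {P : Multisection E F A}
    (hP : P ∈ multisectionDeg E F A k) : L.lieOperator X P ∈ multisectionDeg E F A k :=
  fun x => L.lieDeriv_mem X hP x

theorem schouten_zero_right (P : Multisection E F A) (x : M) : L.schouten P 0 x = 0 := by
  have h := L.schouten_add_right P 0 0 x
  rwa [add_zero, left_eq_add] at h

theorem schouten_eq_zero_of_eventually {x : M} (P : Multisection E F A) {Q : Multisection E F A}
    (hQ : ∀ᶠ y in 𝓝 x, Q.1 y = 0) : L.schouten P Q x = 0 := by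
  rw [L.schouten_congr (P' := P) (Q' := 0) (.of_forall fun _ => rfl) hQ, schouten_zero_right]

theorem isLocalOperator_lieOperator (X : Cₛ^∞⟮𝓘(ℝ, E); F, A⟯) :
    IsLocalOperator (L.lieOperator X) := fun _ _ hP => L.schouten_eq_zero_of_eventually _ hP

/-- The difference of the two sides is a local operator in `P`. It kills functions because the
anchor respects brackets, and commutes with left multiplication by sections because of the Jacobi
identity. -/
theorem lieOperator_bracket (X Y : Cₛ^∞⟮𝓘(ℝ, E); F, A⟯) (P : Multisection E F A) :
    L.lieOperator (L.bracket X Y) P =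
      L.lieOperator X (L.lieOperator Y P) - L.lieOperator Y (L.lieOperator X P) := by
  have hl := L.isLocalOperator_lieOperator
  have h : L.lieOperator (L.bracket X Y) - (L.lieOperator X ∘ₗ L.lieOperator Y -
      L.lieOperator Y ∘ₗ L.lieOperator X) = 0 := by
    refine IsLocalOperator.eq_zero ((hl _).sub (((hl X).comp (hl Y)).sub ((hl Y).comp (hl X))))
      (fun f => ?_) (fun Z Q x hx => ?_)
    · refine sub_eq_zero.2 ?_
      simp only [LinearMap.sub_apply, LinearMap.comp_apply, lieOperator_ofFunction,
        ← ofFunction_sub]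
      exact congrArg ofFunction (ContMDiffMap.ext fun x => L.anchor_bracket X Y f x)
    · have e : (L.lieOperator (L.bracket X Y) - (L.lieOperator X ∘ₗ L.lieOperator Y -
          L.lieOperator Y ∘ₗ L.lieOperator X)) (ofSection Z * Q) = ofSection Z *
          (L.lieOperator (L.bracket X Y) - (L.lieOperator X ∘ₗ L.lieOperator Y -
          L.lieOperator Y ∘ₗ L.lieOperator X)) Q := by
        have hj : (ofSection (L.bracket X (L.bracket Y Z)) : Multisection E F A) =
            ofSection (L.bracket (L.bracket X Y) Z) + ofSection (L.bracket Y (L.bracket X Z)) := by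
          rw [← ofSection_add, ← L.jacobi]
        simp only [LinearMap.sub_apply, LinearMap.comp_apply, lieOperator_mul,
          lieOperator_ofSection, map_add, hj]
        simp only [add_mul, mul_sub]
        abel
      rw [e]
      exact (congrArg ((ofSection Z : Multisection E F A).1 x * ·) hx).trans (mul_zero _)
  exact sub_eq_zero.1 (LinearMap.congr_fun h P)

end LieAlgebroid

end LocalOperators

/-! ### From a divergence operator to a generator -/

section Divergence

variable {E : Type*} [NormedAddCommGroup E] [NormedSpace ℝ E]
  {M : Type*} [TopologicalSpace M] [ChartedSpace E M]
  {F : Type*} [NormedAddCommGroup F] [NormedSpace ℝ F]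
  {A : M → Type*} [TopologicalSpace (TotalSpace F A)] [∀ x, TopologicalSpace (A x)]
  [∀ x, AddCommGroup (A x)] [∀ x, Module ℝ (A x)] [FiberBundle F A] [VectorBundle ℝ F A]
  [FiniteDimensional ℝ F] [ContMDiffVectorBundle ∞ F A 𝓘(ℝ, E)]
  [IsManifold 𝓘(ℝ, E) ∞ M] [FiniteDimensional ℝ E] [T2Space M]

namespace LieAlgebroid

/-- A divergence operator: an additive map `div` from sections to functions such that
`div (f X) = f div X - a(X) f`. -/
structure IsDivergence (L : LieAlgebroid E F A)
    (div : Cₛ^∞⟮𝓘(ℝ, E); F, A⟯ → C^∞⟮𝓘(ℝ, E), M; 𝓘(ℝ, ℝ), ℝ⟯) : Prop where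
  add : ∀ X Y, div (X + Y) = div X + div Y
  smul : ∀ f X x, div (f • X) x = f x * div X x - L.anchorDeriv X f x

variable {L : LieAlgebroid E F A}
  {div : Cₛ^∞⟮𝓘(ℝ, E); F, A⟯ → C^∞⟮𝓘(ℝ, E), M; 𝓘(ℝ, ℝ), ℝ⟯}

omit [FiniteDimensional ℝ F] [ContMDiffVectorBundle ∞ F A 𝓘(ℝ, E)] [FiniteDimensional ℝ E]
  [T2Space M] in
theorem IsDivergence.zero (h : L.IsDivergence div) : div 0 = 0 := by
  have := h.add 0 0
  rwa [add_zero, left_eq_add] at this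

omit [FiniteDimensional ℝ F] [ContMDiffVectorBundle ∞ F A 𝓘(ℝ, E)] in
-- Take χ with χX = 0 and χ = 1 near `x`: the derivative of χ at `x` vanishes, so the rule for
-- div(χX) leaves only div X.
theorem IsDivergence.apply_eq_zero (h : L.IsDivergence div) {x : M} {X : Cₛ^∞⟮𝓘(ℝ, E); F, A⟯}
    (hX : ∀ᶠ y in 𝓝 x, X y = 0) : div X x = 0 := by
  obtain ⟨χ, h1, hχ⟩ := exists_cutoff_smul_eq_zero hX
  have h2 := h.smul χ X x
  rw [hχ, h.zero, h1.self_of_nhds, one_mul, anchorDeriv_apply, dirDeriv_congr (g := fun _ => 1) _ h1,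
    dirDeriv_const, sub_zero] at h2
  exact h2.symm

omit [FiniteDimensional ℝ F] [ContMDiffVectorBundle ∞ F A 𝓘(ℝ, E)] in
theorem IsDivergence.congr (h : L.IsDivergence div) {x : M} {X Y : Cₛ^∞⟮𝓘(ℝ, E); F, A⟯}
    (hXY : ∀ᶠ y in 𝓝 x, X y = Y y) : div X x = div Y x := by
  have h1 : div (X - Y) x = 0 := h.apply_eq_zero (hXY.mono fun y hy => sub_eq_zero.2 hy)
  have h2 := h.add (X - Y) Y
  rw [sub_add_cancel] at h2
  rw [h2]
  exact (congrArg (· + div Y x) h1).trans (zero_add _)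

omit [FiniteDimensional ℝ F] [ContMDiffVectorBundle ∞ F A 𝓘(ℝ, E)] [FiniteDimensional ℝ E]
  [T2Space M] in
theorem IsDivergence.sum_apply (h : L.IsDivergence div) {ι : Type*} (t : Finset ι)
    (X : ι → Cₛ^∞⟮𝓘(ℝ, E); F, A⟯) (x : M) : div (∑ i ∈ t, X i) x = ∑ i ∈ t, div (X i) x := by
  classical
  induction t using Finset.induction_on with
  | empty => rw [Finset.sum_empty, Finset.sum_empty, h.zero]; rfl
  | insert i t hi ih =>
    rw [Finset.sum_insert hi, Finset.sum_insert hi, h.add, ← ih]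
    rfl

variable (L div)

/-- The operator on multisections which a divergence operator determines: at a point `x` it is
given by a formula in the local frame near `x`. -/
def divergenceGenerator (P : Multisection E F A) (x : M) : ExteriorAlgebra ℝ (A x) :=
  ExteriorAlgebra.map ((trivializationAt F A x).symmL ℝ x : F →ₗ[ℝ] A x)
    (generatorSymbol (coframe F) (fun i j => ExteriorAlgebra.ι ℝ (L.frameBracket x i j))
      (fun i => div (frame x i) x) (localRep F x P.1 x) (fun i => L.frameDeriv x i P.1))

theorem divergenceGenerator_congr {x : M} {P Q : Multisection E F A}
    (h : ∀ᶠ y in 𝓝 x, P.1 y = Q.1 y) :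
    L.divergenceGenerator div P x = L.divergenceGenerator div Q x := by
  simp only [divergenceGenerator, L.frameDeriv_congr _ h,
    localRep_congr (F := F) (x₀ := x) h.self_of_nhds]

theorem divergenceGenerator_add (P Q : Multisection E F A) (x : M) :
    L.divergenceGenerator div (P + Q) x =
      L.divergenceGenerator div P x + L.divergenceGenerator div Q x := by
  have h : localRep F x (P + Q).1 x = _ := localRep_add x P.1 Q.1 x
  rw [divergenceGenerator, divergenceGenerator, divergenceGenerator, ← map_add, h]
  congr 1
  simp only [generatorSymbol, frameDeriv_add, map_add, mul_add, smul_add, Finset.sum_add_distrib]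
  abel

theorem divergenceGenerator_smul (r : ℝ) (P : Multisection E F A) (x : M) :
    L.divergenceGenerator div (r • P) x = r • L.divergenceGenerator div P x := by
  have h : localRep F x (r • P).1 x = r • localRep F x P.1 x := localRep_smul x r rfl
  have hd : ∀ i, L.frameDeriv x i (r • P).1 = r • L.frameDeriv x i P.1 := fun i => by
    rw [← ofFunction_const_mul, frameDeriv_mul, frameDeriv_ofFunction, anchorDeriv_const,
      localRep_ofFunction, map_zero, zero_mul, zero_add, ← Algebra.smul_def]
    rfl
  rw [divergenceGenerator, divergenceGenerator, ← map_smul, h]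
  congr 1
  simp only [generatorSymbol, hd, map_smul, mul_smul_comm, smul_add, smul_neg, Finset.smul_sum,
    smul_comm r]

theorem divergenceGenerator_ofFunction (f : C^∞⟮𝓘(ℝ, E), M; 𝓘(ℝ, ℝ), ℝ⟯) (x : M) :
    L.divergenceGenerator div (ofFunction f) x = 0 := by
  rw [divergenceGenerator, localRep_ofFunction]
  simp only [generatorSymbol, frameDeriv_ofFunction, CliffordAlgebra.contractLeft_algebraMap,
    map_zero, mul_zero, smul_zero, Finset.sum_const_zero, neg_zero, add_zero]

/-- No property of `div` enters, since its contribution is an antiderivation. The divergence rule is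
needed only to identify the values on sections and to get smoothness. -/
theorem schouten_eq_divergenceGenerator {k : ℕ} {P : Multisection E F A}
    (hP : P ∈ multisectionDeg E F A k) (Q : Multisection E F A) (x : M) :
    L.schouten P Q x = (-1 : ℝ) ^ k • (L.divergenceGenerator div (P * Q) x
      - L.divergenceGenerator div P x * Q.1 x
      - (-1 : ℝ) ^ k • (P.1 x * L.divergenceGenerator div Q x)) := by
  have h : localRep F x (P * Q).1 x = _ := localRep_mul x P.1 Q.1 x
  rw [schouten_eq, schoutenSymbol_eq_generatorSymbol (coframe F) (L.frameBracket x)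
    (L.frameBracket_skew x) (fun i => div (frame x i) x) (s := (-1 : ℝ) ^ k)
    (by rw [← mul_pow, neg_one_mul, neg_neg, one_pow])
    (involute_of_mem (localRep_mem hP x x)) fun i => involute_of_mem (L.frameDeriv_mem x i hP)]
  simp only [map_smul, map_sub, map_mul,
    map_symmL_localRep (FiberBundle.mem_baseSet_trivializationAt' x), divergenceGenerator, h,
    frameDeriv_mul]

theorem divergenceGenerator_section_mul (X : Cₛ^∞⟮𝓘(ℝ, E); F, A⟯) (Q : Multisection E F A) (x : M) :
    L.divergenceGenerator div (ofSection X * Q) x =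
      L.divergenceGenerator div (ofSection X) x * Q.1 x
      - (ofSection X : Multisection E F A).1 x * L.divergenceGenerator div Q x
      - L.lieDeriv X Q x := by
  rw [lieDeriv, L.schouten_eq_divergenceGenerator div (ofSection_mem X) Q x, pow_one, neg_one_smul,
    neg_one_smul]
  abel

theorem divergenceGenerator_mem_of_succ {k : ℕ} {P : Multisection E F A}
    (hP : P ∈ multisectionDeg E F A (k + 1)) (x : M) :
    L.divergenceGenerator div P x ∈ ⋀[ℝ]^k (A x) := by
  refine map_mem_exteriorPower _ ?_
  have h2 : ∀ i j, ExteriorAlgebra.ι ℝ (L.frameBracket x i j) *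
      CliffordAlgebra.contractLeft (Q := (0 : QuadraticForm ℝ F)) (coframe F i)
        (CliffordAlgebra.contractLeft (Q := (0 : QuadraticForm ℝ F)) (coframe F j)
          (localRep F x P.1 x)) ∈ ⋀[ℝ]^k F := fun i j =>
    ι_mul_contractLeft_mem (contractLeft_mem (localRep_mem hP x x) _) _ _
  exact Submodule.add_mem _ (Submodule.add_mem _
    (Submodule.neg_mem _ (Submodule.sum_mem _ fun i _ =>
      contractLeft_mem (L.frameDeriv_mem x i hP) _))
    (Submodule.smul_mem _ _ (Submodule.sum_mem _ fun i _ => Submodule.sum_mem _ fun j _ => h2 i j)))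
    (Submodule.sum_mem _ fun i _ => Submodule.smul_mem _ _
      (contractLeft_mem (localRep_mem hP x x) _))

variable {L div}

/-- With X = Σ fᵢeᵢ near `x`, the divergence rule gives div X = Σ (fᵢ div eᵢ − a(eᵢ)fᵢ), which is
the frame formula in degree one, where double contractions vanish. -/
theorem IsDivergence.divergenceGenerator_ofSection (h : L.IsDivergence div)
    (X : Cₛ^∞⟮𝓘(ℝ, E); F, A⟯) (x : M) :
    L.divergenceGenerator div (ofSection X) x = algebraMap ℝ _ (div X x) := by
  obtain ⟨f, hf, hX⟩ := exists_frame_expansion x X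
  have hdiv : div X x = -∑ i, coframe F i (L.sectionDeriv x i X) + ∑ i, div (frame x i) x *
      coframe F i ((trivializationAt F A x).continuousLinearMapAt ℝ x (X x)) := by
    rw [h.congr hX, h.sum_apply, ← Finset.sum_neg_distrib, ← Finset.sum_add_distrib]
    refine Finset.sum_congr rfl fun i _ => ?_
    rw [h.smul, L.coord_sectionDeriv x i i X (hf i), (hf i).self_of_nhds]
    ring
  rw [divergenceGenerator, localRep_ofSection, hdiv]
  simp only [generatorSymbol, frameDeriv_ofSection, CliffordAlgebra.contractLeft_ι,
    CliffordAlgebra.contractLeft_algebraMap, mul_zero, Finset.sum_const_zero, add_zero,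
    map_add, map_neg, map_sum, AlgHom.commutes, map_mul, Algebra.smul_def]

/-- The recursion for a product with a section expresses the value through smooth data already
known, so induction on germs applies as for the Lie derivative. -/
theorem IsDivergence.isSmoothMultisection (h : L.IsDivergence div) (P : Multisection E F A) :
    IsSmoothMultisection E F (L.divergenceGenerator div P) := by
  refine .of_eventuallyEq fun z => ?_
  refine multisection_induction z (p := fun P => ∃ Q, IsSmoothMultisection E F Q ∧
    ∀ᶠ y in 𝓝 z, L.divergenceGenerator div P y = Q y) (fun f => ?_) (fun X P hP => ?_)
    (fun P P' hP hP' => ?_) (fun P P' h hP => ?_) P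
  · exact ⟨_, (0 : Multisection E F A).2,
      .of_forall fun y => L.divergenceGenerator_ofFunction div f y⟩
  · obtain ⟨Q, hQ, hPQ⟩ := hP
    refine ⟨_, (ofFunction (div X) * P - ofSection X * ⟨Q, hQ⟩ - L.lieOperator X P :
      Multisection E F A).2, ?_⟩
    filter_upwards [hPQ] with y hy
    rw [divergenceGenerator_section_mul, h.divergenceGenerator_ofSection, hy]
    rfl
  · obtain ⟨Q, hQ, hPQ⟩ := hP
    obtain ⟨Q', hQ', hPQ'⟩ := hP'
    refine ⟨_, (⟨Q, hQ⟩ + ⟨Q', hQ'⟩ : Multisection E F A).2, ?_⟩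
    filter_upwards [hPQ, hPQ'] with y hy hy'
    rw [divergenceGenerator_add]
    exact congrArg₂ _ hy hy'
  · obtain ⟨Q, hQ, hPQ⟩ := hP
    refine ⟨Q, hQ, ?_⟩
    filter_upwards [hPQ, h.eventually_nhds] with y hy hy'
    rw [← hy]
    exact (L.divergenceGenerator_congr div hy').symm

theorem IsDivergence.exists_generator (h : L.IsDivergence div) :
    ∃ D : Multisection E F A →ₗ[ℝ] Multisection E F A, L.IsGerstenhaberGenerator D ∧
      ∀ X, D (ofSection X) = ofFunction (div X) := by
  refine ⟨{ toFun := fun P => ⟨L.divergenceGenerator div P, h.isSmoothMultisection P⟩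
            map_add' := fun P Q => multisection_ext fun x => L.divergenceGenerator_add div P Q x
            map_smul' := fun r P => multisection_ext fun x =>
              L.divergenceGenerator_smul div r P x }, ⟨fun P hP => ?_, fun k P hP => ?_,
      fun k P hP Q x => ?_⟩, fun X => ?_⟩
  · obtain ⟨f, rfl⟩ := exists_ofFunction hP
    exact multisection_ext fun x => L.divergenceGenerator_ofFunction div f x
  · exact L.divergenceGenerator_mem_of_succ div hP
  · exact L.schouten_eq_divergenceGenerator div hP Q x
  · exact multisection_ext fun x => h.divergenceGenerator_ofSection X x

end LieAlgebroid

end Divergence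

/-! ### Generators and connections on the top exterior power -/

section Generators

variable {E : Type*} [NormedAddCommGroup E] [NormedSpace ℝ E]
  {M : Type*} [TopologicalSpace M] [ChartedSpace E M]
  {F : Type*} [NormedAddCommGroup F] [NormedSpace ℝ F]
  {A : M → Type*} [TopologicalSpace (TotalSpace F A)] [∀ x, TopologicalSpace (A x)]
  [∀ x, AddCommGroup (A x)] [∀ x, Module ℝ (A x)] [FiberBundle F A] [VectorBundle ℝ F A]
  [FiniteDimensional ℝ F] [ContMDiffVectorBundle ∞ F A 𝓘(ℝ, E)]

theorem exists_top_form : ∃ (w : ExteriorAlgebra ℝ F) (ψ : Module.Dual ℝ (ExteriorAlgebra ℝ F)),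
    w ∈ ⋀[ℝ]^(Module.finrank ℝ F) F ∧ ψ w = 1 ∧
      ∀ a ∈ ⋀[ℝ]^(Module.finrank ℝ F) F, a = ψ a • w := by
  have h1 : Module.finrank ℝ (⋀[ℝ]^(Module.finrank ℝ F) F) = 1 := by
    rw [exteriorPower.finrank_eq, Nat.choose_self]
  obtain ⟨w, hw, hspan⟩ := finrank_eq_one_iff'.1 h1
  -- The functional is taken on the whole exterior algebra, so that it can be fed into the
  -- definition of a smooth multisection; afterwards it is normalised at `w`.
  obtain ⟨ψ, hψ⟩ := Module.Projective.exists_dual_ne_zero ℝ (x := w.1) (by simpa using hw)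
  refine ⟨w, (ψ w)⁻¹ • ψ, w.2, inv_mul_cancel₀ hψ, fun a ha => ?_⟩
  obtain ⟨c, hc⟩ := hspan ⟨a, ha⟩
  have hc' : a = c • w.1 := (congrArg Subtype.val hc).symm
  rw [hc', LinearMap.smul_apply, map_smul, smul_eq_mul, smul_eq_mul, mul_comm c,
    inv_mul_cancel_left₀ hψ]

theorem section_mul_top {Λ : Multisection E F A}
    (hΛ : Λ ∈ multisectionDeg E F A (Module.finrank ℝ F)) (X : Cₛ^∞⟮𝓘(ℝ, E); F, A⟯) :
    ofSection X * Λ = 0 := by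
  have h0 : ⋀[ℝ]^(Module.finrank ℝ F + 1) F = ⊥ := by
    rw [← Submodule.finrank_eq_zero, exteriorPower.finrank_eq, Nat.choose_succ_self]
  refine multisection_ext fun x => ?_
  refine eq_of_localRep_eq (FiberBundle.mem_baseSet_trivializationAt' (F := F) x) ?_
  have h := localRep_mem (ofSection_mul_mem X hΛ) x x
  rw [h0] at h
  exact h.trans (map_zero _).symm

variable [IsManifold 𝓘(ℝ, E) ∞ M] [FiniteDimensional ℝ E] [T2Space M]

namespace LieAlgebroid

variable {L : LieAlgebroid E F A}

section Generator

variable {D : Multisection E F A →ₗ[ℝ] Multisection E F A}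

theorem IsGerstenhaberGenerator.map_ofFunction (hD : L.IsGerstenhaberGenerator D)
    (f : C^∞⟮𝓘(ℝ, E), M; 𝓘(ℝ, ℝ), ℝ⟯) : D (ofFunction f) = 0 :=
  hD.map_zero_deg _ (ofFunction_mem f)

theorem IsGerstenhaberGenerator.map_section_mul (hD : L.IsGerstenhaberGenerator D)
    (X : Cₛ^∞⟮𝓘(ℝ, E); F, A⟯) (Q : Multisection E F A) :
    D (ofSection X * Q) = D (ofSection X) * Q - ofSection X * D Q - L.lieOperator X Q := by
  have h : L.lieOperator X Q = (-1 : ℝ) ^ 1 • (D (ofSection X * Q) - D (ofSection X) * Q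
      - (-1 : ℝ) ^ 1 • (ofSection X * D Q)) :=
    multisection_ext fun x => hD.generates 1 _ (ofSection_mem X) Q x
  rw [h, pow_one, neg_one_smul, neg_one_smul]
  abel

/-- For a function χ the generating identity is [χ,P] = D(χP) − χDP. With χ = 1 near `x` and χP = 0,
the bracket vanishes at `x` and DP is what remains. -/
theorem IsGerstenhaberGenerator.isLocalOperator (hD : L.IsGerstenhaberGenerator D) :
    IsLocalOperator D := fun x P hP => by
  obtain ⟨χ, h1, hχ⟩ := exists_cutoff (E := E) hP
  have h0 : ofFunction χ * P = 0 := multisection_ext fun y => by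
    rw [ofFunction_mul_apply]
    by_cases hy : y ∈ tsupport χ
    · rw [hχ hy, smul_zero]; rfl
    · rw [image_eq_zero_of_notMem_tsupport hy, zero_smul]; rfl
  have h := hD.generates 0 _ (ofFunction_mem χ) P x
  rw [L.schouten_eq_zero_of_eventually _ hP, h0, map_zero, hD.map_ofFunction, pow_zero, one_smul,
    one_smul, zero_mul, sub_zero, zero_sub] at h
  have h2 : (ofFunction χ * D P).1 x = 0 := neg_eq_zero.1 h.symm
  rwa [ofFunction_mul_apply, h1.self_of_nhds, one_smul] at h2

/-- The bracket terms cancel in T = D − D', leaving T(X∧P) = −X∧TP; a local operator of this kind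
that kills functions is zero. -/
theorem IsGerstenhaberGenerator.ext {D' : Multisection E F A →ₗ[ℝ] Multisection E F A}
    (hD : L.IsGerstenhaberGenerator D) (hD' : L.IsGerstenhaberGenerator D')
    (h : ∀ X, D (ofSection X) = D' (ofSection X)) : D = D' := by
  refine sub_eq_zero.1 (IsLocalOperator.eq_zero (hD.isLocalOperator.sub hD'.isLocalOperator)
    (fun f => ?_) fun X P x hx => ?_)
  · rw [LinearMap.sub_apply, hD.map_ofFunction, hD'.map_ofFunction, sub_zero]
  · have e : (D - D') (ofSection X * P) = -(ofSection X * (D - D') P) := by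
      rw [LinearMap.sub_apply, hD.map_section_mul, hD'.map_section_mul, h, LinearMap.sub_apply,
        mul_sub]
      abel
    rw [e]
    exact neg_eq_zero.2 ((congrArg ((ofSection X : Multisection E F A).1 x * ·) hx).trans
      (mul_zero _))

/-- Since X∧Λ = 0 in top degree, the recursion for D(X∧Λ) becomes a relation between X∧DΛ and L_XΛ.
It reconciles the two formulas that link a connection with its generator. -/
theorem IsGerstenhaberGenerator.section_mul_map (hD : L.IsGerstenhaberGenerator D)
    {Λ : Multisection E F A} (hΛ : Λ ∈ multisectionDeg E F A (Module.finrank ℝ F))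
    (X : Cₛ^∞⟮𝓘(ℝ, E); F, A⟯) :
    -(ofSection X * D Λ) = L.lieOperator X Λ - D (ofSection X) * Λ := by
  have h := hD.map_section_mul X Λ
  rw [section_mul_top hΛ, map_zero] at h
  rw [← sub_eq_zero, h]
  abel

theorem IsGerstenhaberGenerator.section_mul_mem (hD : L.IsGerstenhaberGenerator D) {k : ℕ}
    {P : Multisection E F A} (hP : P ∈ multisectionDeg E F A k) (X : Cₛ^∞⟮𝓘(ℝ, E); F, A⟯) :
    -(ofSection X * D P) ∈ multisectionDeg E F A k := by
  refine Submodule.neg_mem _ ?_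
  cases k with
  | zero => rw [hD.map_zero_deg P hP, mul_zero]; exact Submodule.zero_mem _
  | succ k => exact ofSection_mul_mem X (hD.map_succ_deg k P hP)

/-- The connection `∇_X Λ = -X ∧ D Λ` attached to a generator `D`. -/
def IsGerstenhaberGenerator.connection (hD : L.IsGerstenhaberGenerator D) :
    L.AConnection (Module.finrank ℝ F) where
  toFun := LinearMap.mk₂ ℝ
    (fun X Λ => ⟨-(ofSection X * D Λ.1), hD.section_mul_mem Λ.2 X⟩)
    (fun X Y Λ => Subtype.ext (by
      change -(ofSection (X + Y) * D Λ.1) = -(ofSection X * D Λ.1) + -(ofSection Y * D Λ.1)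
      rw [ofSection_add, add_mul, neg_add]))
    (fun r X Λ => Subtype.ext (by
      change -(ofSection (r • X) * D Λ.1) = r • -(ofSection X * D Λ.1)
      rw [ofSection_real_smul, smul_mul_assoc, smul_neg]))
    (fun X Λ Λ' => Subtype.ext (by
      change -(ofSection X * D (Λ.1 + Λ'.1)) = -(ofSection X * D Λ.1) + -(ofSection X * D Λ'.1)
      rw [map_add, mul_add, neg_add]))
    (fun r X Λ => Subtype.ext (by
      change -(ofSection X * D (r • Λ.1)) = r • -(ofSection X * D Λ.1)
      rw [map_smul, mul_smul_comm, smul_neg]))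
  smul_left f X Λ := Subtype.ext (by
    change -(ofSection (f • X) * D Λ.1) = ofFunction f * -(ofSection X * D Λ.1)
    rw [ofSection_smul, mul_assoc]
    exact (mul_neg (ofFunction f : Multisection E F A) _).symm)
  leibniz f X Λ x := by
    have h : -(ofSection X * D (ofFunction f * Λ.1)) =
        ofFunction (L.anchorDeriv X f) * Λ.1 + ofFunction f * -(ofSection X * D Λ.1) := by
      rw [hD.section_mul_map (Λ := ofFunction f * Λ.1) (f • Λ).2, hD.section_mul_map Λ.2,
        L.lieOperator_mul, L.lieOperator_ofFunction, mul_sub, ← mul_assoc, ← mul_assoc,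
        ofFunction_comm f (D (ofSection X))]
      abel
    exact (congrFun (congrArg Subtype.val h) x).trans (ofFunction_mul_add_apply _ _ _ _ x)

theorem IsGerstenhaberGenerator.connection_apply (hD : L.IsGerstenhaberGenerator D)
    (X : Cₛ^∞⟮𝓘(ℝ, E); F, A⟯) (Λ : multisectionDeg E F A (Module.finrank ℝ F)) :
    (hD.connection.toFun X Λ).1 = -(ofSection X * D Λ.1) := rfl

end Generator

/-- Near any point, `⋀ⁿ A` has a nowhere vanishing smooth section. -/
theorem exists_local_top_section (x : M) : ∃ (Λ : multisectionDeg E F A (Module.finrank ℝ F))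
    (w : ExteriorAlgebra ℝ F) (ψ : Module.Dual ℝ (ExteriorAlgebra ℝ F)),
    ψ w = 1 ∧ (∀ a ∈ ⋀[ℝ]^(Module.finrank ℝ F) F, a = ψ a • w) ∧
      ∀ᶠ y in 𝓝 x, localRep F x Λ.1.1 y = w := by
  obtain ⟨w, ψ, hw, h1, h⟩ := exists_top_form (F := F)
  obtain ⟨Λ, hΛ, hw⟩ := exists_const_multisection (E := E) (A := A) x hw
  exact ⟨⟨Λ, hΛ⟩, w, ψ, h1, h, hw⟩

/-- Some top section does not vanish at `x`. Identities between functions can therefore be checked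
after multiplication with all top sections. -/
theorem eq_of_forall_smul_top {x : M} {r s : ℝ}
    (h : ∀ Λ : multisectionDeg E F A (Module.finrank ℝ F), r • Λ.1.1 x = s • Λ.1.1 x) : r = s := by
  obtain ⟨Λ, w, ψ, h1, -, hΛ⟩ := exists_local_top_section (E := E) (A := A) (F := F) x
  have hx := congrArg (fun a => ψ (ExteriorAlgebra.map
    ((trivializationAt F A x).continuousLinearMapAt ℝ x : A x →ₗ[ℝ] F) a)) (h Λ)
  simp only [map_smul] at hx
  have hw : ExteriorAlgebra.map ((trivializationAt F A x).continuousLinearMapAt ℝ x : A x →ₗ[ℝ] F)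
      (Λ.1.1 x) = w := hΛ.self_of_nhds
  simpa [hw, h1] using hx

theorem eq_of_forall_ofFunction_mul_top {f g : C^∞⟮𝓘(ℝ, E), M; 𝓘(ℝ, ℝ), ℝ⟯}
    (h : ∀ Λ : multisectionDeg E F A (Module.finrank ℝ F),
      ofFunction f * Λ.1 = ofFunction g * Λ.1) : f = g :=
  ContMDiffMap.ext fun x => eq_of_forall_smul_top (A := A) (F := F) fun Λ => by
    rw [← ofFunction_mul_apply, ← ofFunction_mul_apply, h]

/-- A local and function-linear endomorphism of top degree multisections is the multiplication by
a function. -/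
theorem exists_function_of_tensorial
    {T : multisectionDeg E F A (Module.finrank ℝ F) → multisectionDeg E F A (Module.finrank ℝ F)}
    (hT : ∀ (f : C^∞⟮𝓘(ℝ, E), M; 𝓘(ℝ, ℝ), ℝ⟯) Λ, T (f • Λ) = f • T Λ) :
    ∃ g : C^∞⟮𝓘(ℝ, E), M; 𝓘(ℝ, ℝ), ℝ⟯, ∀ Λ, (T Λ).1 = ofFunction g * Λ.1 := by
  -- A cutoff supported where the two sections agree turns function-linearity into locality.
  have hlocal : ∀ (x : M) (Λ Λ' : multisectionDeg E F A (Module.finrank ℝ F)),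
      (∀ᶠ y in 𝓝 x, Λ.1.1 y = Λ'.1.1 y) → (T Λ).1.1 x = (T Λ').1.1 x := by
    intro x Λ Λ' h
    obtain ⟨χ, h1, hχ⟩ := exists_cutoff (E := E) h
    have e : χ • Λ = χ • Λ' := Subtype.ext (multisection_ext fun y => by
      change (ofFunction χ * Λ.1).1 y = (ofFunction χ * Λ'.1).1 y
      rw [ofFunction_mul_apply, ofFunction_mul_apply]
      by_cases hy : y ∈ tsupport χ
      · rw [hχ hy]
      · rw [image_eq_zero_of_notMem_tsupport hy, zero_smul, zero_smul])
    have e2 := hT χ Λ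
    rw [e, hT] at e2
    have e3 : (ofFunction χ * (T Λ').1).1 x = (ofFunction χ * (T Λ).1).1 x :=
      congrArg (fun S : multisectionDeg E F A (Module.finrank ℝ F) => S.1.1 x) e2
    rw [ofFunction_mul_apply, ofFunction_mul_apply, h1.self_of_nhds, one_smul, one_smul] at e3
    exact e3.symm
  -- Near `x` every top section is a function times the local generator `Λ₀`, so the factor is the
  -- coefficient of TΛ₀ with respect to `Λ₀`.
  have hpt : ∀ x : M, ∃ g : M → ℝ, ContMDiffAt 𝓘(ℝ, E) 𝓘(ℝ, ℝ) ∞ g x ∧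
      ∀ᶠ y in 𝓝 x, ∀ Λ, (T Λ).1.1 y = g y • Λ.1.1 y := by
    intro x
    obtain ⟨Λ₀, w, ψ, h1, htop, hΛ₀⟩ := exists_local_top_section (E := E) (A := A) (F := F) x
    refine ⟨fun y => ψ (localRep F x (T Λ₀).1.1 y),
      ((T Λ₀).1.2 x ψ).contMDiffAt (eventually_mem_baseSet x), ?_⟩
    filter_upwards [hΛ₀.eventually_nhds, (eventually_mem_baseSet (F := F) (A := A) x).eventually_nhds]
      with y hw hb Λ
    obtain ⟨f, hf⟩ := exists_smooth_eventuallyEq (trivializationAt F A x).open_baseSet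
      hb.self_of_nhds (Λ.1.2 x ψ)
    have hΛ : ∀ᶠ z in 𝓝 y, Λ.1.1 z = (f • Λ₀).1.1 z := by
      filter_upwards [hf, hw, hb] with z hz hwz hbz
      refine eq_of_localRep_eq hbz ?_
      have e : localRep F x (f • Λ₀).1.1 z = f z • localRep F x Λ₀.1.1 z :=
        localRep_smul x (f z) (ofFunction_mul_apply f Λ₀.1 z)
      rw [e, hwz, hz]
      exact htop _ (localRep_mem Λ.2 x z)
    rw [hlocal y _ _ hΛ, hΛ.self_of_nhds, hT]
    have e1 : (f • T Λ₀).1.1 y = f y • (T Λ₀).1.1 y := ofFunction_mul_apply f _ y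
    have e2 : (f • Λ₀).1.1 y = f y • Λ₀.1.1 y := ofFunction_mul_apply f _ y
    rw [e1, e2, smul_comm]
    congr 1
    have e3 : localRep F x (T Λ₀).1.1 y = ψ (localRep F x (T Λ₀).1.1 y) • localRep F x Λ₀.1.1 y := by
      rw [hw.self_of_nhds]
      exact htop _ (localRep_mem (T Λ₀).2 x y)
    rw [← map_symmL_localRep hb.self_of_nhds (T Λ₀).1.1, e3, map_smul,
      map_symmL_localRep hb.self_of_nhds, ← e3]
  choose g hg hgT using hpt
  -- The factor at a point is unique, so the diagonal function agrees near `x` with the smooth germ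
  -- `g x`.
  have hsmooth : ContMDiff 𝓘(ℝ, E) 𝓘(ℝ, ℝ) ∞ fun x => g x x := fun x => by
    refine (hg x).congr_of_eventuallyEq ?_
    filter_upwards [hgT x] with y hy
    exact eq_of_forall_smul_top (A := A) (F := F) fun Λ =>
      ((hgT y).self_of_nhds Λ).symm.trans (hy Λ)
  refine ⟨⟨fun x => g x x, hsmooth⟩, fun Λ => multisection_ext fun x => ?_⟩
  exact ((hgT x).self_of_nhds Λ).trans (ofFunction_mul_apply
    (⟨_, hsmooth⟩ : C^∞⟮𝓘(ℝ, E), M; 𝓘(ℝ, ℝ), ℝ⟯) Λ.1 x).symm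

variable (L)

theorem schoutenSymbol_smul_add {R V I : Type*} [CommRing R] [AddCommGroup V] [Module R V]
    [Fintype I] (d : I → Module.Dual R V) (e : I → I → ExteriorAlgebra R V) (r : R) (c : I → R)
    (p : ExteriorAlgebra R V) (dp : I → ExteriorAlgebra R V)
    (q : ExteriorAlgebra R V) (dq : I → ExteriorAlgebra R V) :
    schoutenSymbol d e (r • p) (fun i => c i • p + r • dp i) q dq =
      r • schoutenSymbol d e p dp q dq - ∑ i, c i •
        (p * CliffordAlgebra.contractLeft (Q := (0 : QuadraticForm R V)) (d i) q) := by
  simp only [schoutenSymbol, map_smul, LinearMap.smul_apply, smul_mul_assoc, add_mul, smul_add,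
    Finset.smul_sum, smul_sub, Finset.sum_sub_distrib, Finset.sum_add_distrib]
  abel

/-- Differentiating `f` contributes −Σ (a(eᵢ)f) X∧ιᵢΛ, with ιᵢ the contraction by the dual coframe.
Contracting X∧Λ = 0 gives X∧ιᵢΛ = eⁱ(X)Λ, and the sum becomes −(a(X)f)Λ. -/
theorem lieOperator_smul_top (f : C^∞⟮𝓘(ℝ, E), M; 𝓘(ℝ, ℝ), ℝ⟯) (X : Cₛ^∞⟮𝓘(ℝ, E); F, A⟯)
    {Λ : Multisection E F A} (hΛ : Λ ∈ multisectionDeg E F A (Module.finrank ℝ F)) :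
    L.lieOperator (f • X) Λ =
      ofFunction f * L.lieOperator X Λ - ofFunction (L.anchorDeriv X f) * Λ := by
  refine multisection_ext fun x => ?_
  have hv : ExteriorAlgebra.ι ℝ ((trivializationAt F A x).continuousLinearMapAt ℝ x (X x)) *
      localRep F x Λ.1 x = 0 := by
    rw [← localRep_ofSection, ← localRep_mul]
    exact (localRep_congr (congrFun (congrArg Subtype.val (section_mul_top hΛ X)) x)).trans
      (map_zero _)
  have hcontr : ∀ i, ExteriorAlgebra.ι ℝ
      ((trivializationAt F A x).continuousLinearMapAt ℝ x (X x)) *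
        CliffordAlgebra.contractLeft (Q := (0 : QuadraticForm ℝ F)) (coframe F i)
          (localRep F x Λ.1 x) =
      coframe F i ((trivializationAt F A x).continuousLinearMapAt ℝ x (X x)) •
        localRep F x Λ.1 x := fun i => by
    have h := CliffordAlgebra.contractLeft_ι_mul (Q := (0 : QuadraticForm ℝ F)) (coframe F i)
      ((trivializationAt F A x).continuousLinearMapAt ℝ x (X x)) (localRep F x Λ.1 x)
    rw [hv, map_zero] at h
    exact (sub_eq_zero.1 h.symm).symm
  have hfX : localRep F x (ofFunction f * ofSection X : Multisection E F A).1 x =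
      f x • localRep F x (ofSection X : Multisection E F A).1 x :=
    localRep_smul x (f x) (ofFunction_mul_apply f _ x)
  have hd : ∀ i, L.frameDeriv x i (ofFunction f * ofSection X : Multisection E F A).1 =
      L.anchorDeriv (frame x i) f x • localRep F x (ofSection X : Multisection E F A).1 x
        + f x • L.frameDeriv x i (ofSection X : Multisection E F A).1 := fun i => by
    rw [frameDeriv_mul, frameDeriv_ofFunction, localRep_ofFunction, ← Algebra.smul_def,
      ← Algebra.smul_def]
  have h1 : L.lieDeriv (f • X) Λ x = f x • L.lieDeriv X Λ x - L.anchorDeriv X f x • Λ.1 x := by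
    rw [lieDeriv, lieDeriv, ofSection_smul, schouten_eq, schouten_eq, hfX]
    simp only [hd]
    rw [schoutenSymbol_smul_add, map_sub, map_smul, localRep_ofSection]
    simp only [hcontr, smul_smul]
    rw [← Finset.sum_smul, map_smul,
      map_symmL_localRep (FiberBundle.mem_baseSet_trivializationAt' x), L.anchorDeriv_eq_sum X f x]
    simp only [mul_comm]
  rw [lieOperator_apply, h1, ← lieOperator_apply, ← ofFunction_mul_apply, ← ofFunction_mul_apply]
  rfl

variable {L}

/-- The derivative terms of L_X and ∇_X cancel, so their difference is tensorial on a line bundle,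
hence a function. Its dependence on `X` is then tested against top sections. -/
theorem AConnection.exists_divergence (C : L.AConnection (Module.finrank ℝ F)) :
    ∃ div, L.IsDivergence div ∧ ∀ X (Λ : multisectionDeg E F A (Module.finrank ℝ F)),
      ofFunction (div X) * Λ.1 = L.lieOperator X Λ.1 - (C.toFun X Λ).1 := by
  have hC : ∀ (f : C^∞⟮𝓘(ℝ, E), M; 𝓘(ℝ, ℝ), ℝ⟯) X (Λ : multisectionDeg E F A (Module.finrank ℝ F)),
      (C.toFun X (f • Λ)).1 =
        ofFunction (L.anchorDeriv X f) * Λ.1 + ofFunction f * (C.toFun X Λ).1 := fun f X Λ =>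
    multisection_ext fun x => (C.leibniz f X Λ x).trans
      (ofFunction_mul_add_apply (L.anchorDeriv X f) f Λ.1 (C.toFun X Λ).1 x).symm
  have h : ∀ X, ∃ g : C^∞⟮𝓘(ℝ, E), M; 𝓘(ℝ, ℝ), ℝ⟯,
      ∀ Λ : multisectionDeg E F A (Module.finrank ℝ F),
        L.lieOperator X Λ.1 - (C.toFun X Λ).1 = ofFunction g * Λ.1 := fun X =>
    exists_function_of_tensorial
      (T := fun Λ => ⟨L.lieOperator X Λ.1 - (C.toFun X Λ).1,
        Submodule.sub_mem _ (L.lieOperator_mem X Λ.2) (C.toFun X Λ).2⟩) fun f Λ => Subtype.ext (by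
      change L.lieOperator X (ofFunction f * Λ.1) - (C.toFun X (f • Λ)).1 =
        ofFunction f * (L.lieOperator X Λ.1 - (C.toFun X Λ).1)
      rw [hC, L.lieOperator_mul, L.lieOperator_ofFunction, mul_sub]
      abel)
  choose div hdiv using h
  refine ⟨div, ⟨fun X Y => ?_, fun f X x => ?_⟩, fun X Λ => (hdiv X Λ).symm⟩
  · refine eq_of_forall_ofFunction_mul_top (A := A) (F := F) fun Λ => ?_
    have hadd : L.lieOperator (X + Y) Λ.1 = L.lieOperator X Λ.1 + L.lieOperator Y Λ.1 :=
      multisection_ext fun x => by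
        rw [lieOperator_apply, lieDeriv, ofSection_add, L.schouten_add_left]
        rfl
    rw [← hdiv, ofFunction_add, add_mul, ← hdiv, ← hdiv, hadd, map_add]
    change _ - ((C.toFun X Λ).1 + (C.toFun Y Λ).1) = _
    abel
  · suffices h : div (f • X) = f * div X - L.anchorDeriv X f by rw [h]; rfl
    refine eq_of_forall_ofFunction_mul_top (A := A) (F := F) fun Λ => ?_
    rw [← hdiv, ofFunction_sub, sub_mul, ofFunction_mul, mul_assoc, ← hdiv,
      L.lieOperator_smul_top f X Λ.2, C.smul_left]
    change _ - ofFunction f * (C.toFun X Λ).1 = _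
    rw [mul_sub]
    abel

omit [ContMDiffVectorBundle ∞ F A 𝓘(ℝ, E)] [FiniteDimensional ℝ E] [T2Space M] in
theorem AConnection.ext_val {k : ℕ} {C C' : L.AConnection k}
    (h : ∀ X Λ, (C.toFun X Λ).1 = (C'.toFun X Λ).1) : C = C' := by
  have e : C.toFun = C'.toFun := LinearMap.ext fun X => LinearMap.ext fun Λ => Subtype.ext (h X Λ)
  cases C; cases C'; cases e; rfl

theorem AConnection.exists_generator (C : L.AConnection (Module.finrank ℝ F)) :
    ∃ (D : Multisection E F A →ₗ[ℝ] Multisection E F A) (hD : L.IsGerstenhaberGenerator D),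
      hD.connection = C := by
  obtain ⟨div, hdiv, h⟩ := C.exists_divergence
  obtain ⟨D, hD, hDX⟩ := hdiv.exists_generator
  refine ⟨D, hD, AConnection.ext_val fun X Λ => ?_⟩
  rw [hD.connection_apply, hD.section_mul_map Λ.2, hDX, h]
  abel

/-- The connection determines (DX)Λ for every top Λ, hence the function DX, and a generator is
determined by its values on sections. -/
theorem IsGerstenhaberGenerator.eq_of_connection_eq
    {D D' : Multisection E F A →ₗ[ℝ] Multisection E F A} (hD : L.IsGerstenhaberGenerator D)
    (hD' : L.IsGerstenhaberGenerator D') (h : hD.connection = hD'.connection) : D = D' := by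
  refine hD.ext hD' fun X => ?_
  obtain ⟨f, hf⟩ := exists_ofFunction (hD.map_succ_deg 0 _ (ofSection_mem X))
  obtain ⟨f', hf'⟩ := exists_ofFunction (hD'.map_succ_deg 0 _ (ofSection_mem X))
  rw [hf, hf']
  refine congrArg _ (eq_of_forall_ofFunction_mul_top (A := A) (F := F) fun Λ => ?_)
  have e : (hD.connection.toFun X Λ).1 = (hD'.connection.toFun X Λ).1 := by rw [h]
  rw [hD.connection_apply, hD'.connection_apply, hD.section_mul_map Λ.2, hD'.section_mul_map Λ.2,
    hf, hf'] at e
  exact sub_right_injective e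

end LieAlgebroid

end Generators

/-! ### Curvature and the square of the generator -/

section Flatness

variable {E : Type*} [NormedAddCommGroup E] [NormedSpace ℝ E]
  {M : Type*} [TopologicalSpace M] [ChartedSpace E M]
  {F : Type*} [NormedAddCommGroup F] [NormedSpace ℝ F]
  {A : M → Type*} [TopologicalSpace (TotalSpace F A)] [∀ x, TopologicalSpace (A x)]
  [∀ x, AddCommGroup (A x)] [∀ x, Module ℝ (A x)] [FiberBundle F A] [VectorBundle ℝ F A]
  [FiniteDimensional ℝ F] [ContMDiffVectorBundle ∞ F A 𝓘(ℝ, E)]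
  [IsManifold 𝓘(ℝ, E) ∞ M] [FiniteDimensional ℝ E] [T2Space M]

namespace LieAlgebroid

variable {L : LieAlgebroid E F A} {D : Multisection E F A →ₗ[ℝ] Multisection E F A}

theorem IsGerstenhaberGenerator.exists_divergence (hD : L.IsGerstenhaberGenerator D) :
    ∃ div : Cₛ^∞⟮𝓘(ℝ, E); F, A⟯ → C^∞⟮𝓘(ℝ, E), M; 𝓘(ℝ, ℝ), ℝ⟯,
      ∀ X, D (ofSection X) = ofFunction (div X) := by
  choose div h using fun X => exists_ofFunction (hD.map_succ_deg 0 _ (ofSection_mem X))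
  exact ⟨div, h⟩

variable (L) in
/-- The function `div [X, Y] - a(X) div Y + a(Y) div X`, which is the curvature of a connection with
divergence `div`. -/
def divergenceCurvature (div : Cₛ^∞⟮𝓘(ℝ, E); F, A⟯ → C^∞⟮𝓘(ℝ, E), M; 𝓘(ℝ, ℝ), ℝ⟯)
    (X Y : Cₛ^∞⟮𝓘(ℝ, E); F, A⟯) : C^∞⟮𝓘(ℝ, E), M; 𝓘(ℝ, ℝ), ℝ⟯ :=
  div (L.bracket X Y) - L.anchorDeriv X (div Y) + L.anchorDeriv Y (div X)

omit [ContMDiffVectorBundle ∞ F A 𝓘(ℝ, E)] [FiniteDimensional ℝ E] [T2Space M] in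
theorem ofFunction_divergenceCurvature
    (div : Cₛ^∞⟮𝓘(ℝ, E); F, A⟯ → C^∞⟮𝓘(ℝ, E), M; 𝓘(ℝ, ℝ), ℝ⟯) (X Y : Cₛ^∞⟮𝓘(ℝ, E); F, A⟯) :
    (ofFunction (L.divergenceCurvature div X Y) : Multisection E F A) =
      ofFunction (div (L.bracket X Y)) - ofFunction (L.anchorDeriv X (div Y))
        + ofFunction (L.anchorDeriv Y (div X)) := by
  rw [divergenceCurvature, ofFunction_add, ofFunction_sub]

variable {div : Cₛ^∞⟮𝓘(ℝ, E); F, A⟯ → C^∞⟮𝓘(ℝ, E), M; 𝓘(ℝ, ℝ), ℝ⟯}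

/-- On top sections ∇_X = L_X − div X. The Lie derivatives represent the bracket and functions
commute, so only the derivatives of the divergences and div[X,Y] survive. -/
theorem IsGerstenhaberGenerator.curvature_apply (hD : L.IsGerstenhaberGenerator D)
    (hdiv : ∀ X, D (ofSection X) = ofFunction (div X)) (X Y : Cₛ^∞⟮𝓘(ℝ, E); F, A⟯)
    (Λ : multisectionDeg E F A (Module.finrank ℝ F)) :
    (hD.connection.curvature X Y Λ).1 = ofFunction (L.divergenceCurvature div X Y) * Λ.1 := by
  have h : ∀ X Λ, (hD.connection.toFun X Λ).1 = L.lieOperator X Λ.1 - ofFunction (div X) * Λ.1 :=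
    fun X Λ => by rw [hD.connection_apply, hD.section_mul_map Λ.2, hdiv]
  have hcomm : (ofFunction (div Y) * (ofFunction (div X) * Λ.1) : Multisection E F A) =
      ofFunction (div X) * (ofFunction (div Y) * Λ.1) := by
    rw [← mul_assoc, ← mul_assoc, ofFunction_comm]
  change (hD.connection.toFun X (hD.connection.toFun Y Λ)).1
      - (hD.connection.toFun Y (hD.connection.toFun X Λ)).1
      - (hD.connection.toFun (L.bracket X Y) Λ).1 = _
  simp only [h, map_sub, L.lieOperator_mul, L.lieOperator_ofFunction, L.lieOperator_bracket,
    ofFunction_divergenceCurvature, add_mul, sub_mul, mul_sub, hcomm]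
  abel

theorem IsGerstenhaberGenerator.isFlat_iff (hD : L.IsGerstenhaberGenerator D)
    (hdiv : ∀ X, D (ofSection X) = ofFunction (div X)) :
    hD.connection.IsFlat ↔ ∀ X Y, L.divergenceCurvature div X Y = 0 := by
  have h0 : (ofFunction (0 : C^∞⟮𝓘(ℝ, E), M; 𝓘(ℝ, ℝ), ℝ⟯) : Multisection E F A) = 0 :=
    multisection_ext fun x => map_zero (algebraMap ℝ (ExteriorAlgebra ℝ (A x)))
  constructor
  · intro h X Y
    refine eq_of_forall_ofFunction_mul_top (A := A) (F := F) fun Λ => ?_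
    rw [← hD.curvature_apply hdiv, h X Y Λ, h0, zero_mul]
    rfl
  · intro h X Y Λ
    refine Subtype.ext ?_
    rw [hD.curvature_apply hdiv, h, h0, zero_mul]
    rfl

variable (L D) in
/-- The failure of the generator `D` to be a derivation of the bracket with the section `X`, whose
divergence is `f`. -/
def bracketDefect (X : Cₛ^∞⟮𝓘(ℝ, E); F, A⟯) (f : C^∞⟮𝓘(ℝ, E), M; 𝓘(ℝ, ℝ), ℝ⟯) :
    Multisection E F A →ₗ[ℝ] Multisection E F A :=
  D ∘ₗ L.lieOperator X - L.lieOperator X ∘ₗ D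
    - (D ∘ₗ LinearMap.mulLeft ℝ (ofFunction f) - LinearMap.mulLeft ℝ (ofFunction f) ∘ₗ D)

theorem bracketDefect_apply (X : Cₛ^∞⟮𝓘(ℝ, E); F, A⟯) (f : C^∞⟮𝓘(ℝ, E), M; 𝓘(ℝ, ℝ), ℝ⟯)
    (Q : Multisection E F A) : L.bracketDefect D X f Q =
      D (L.lieOperator X Q) - L.lieOperator X (D Q)
        - (D (ofFunction f * Q) - ofFunction f * D Q) := rfl

theorem IsGerstenhaberGenerator.isLocalOperator_bracketDefect (hD : L.IsGerstenhaberGenerator D)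
    (X : Cₛ^∞⟮𝓘(ℝ, E); F, A⟯) (f : C^∞⟮𝓘(ℝ, E), M; 𝓘(ℝ, ℝ), ℝ⟯) :
    IsLocalOperator (L.bracketDefect D X f) :=
  have hl := L.isLocalOperator_lieOperator X
  have hf := isLocalOperator_mulLeft (ofFunction f : Multisection E F A)
  ((hD.isLocalOperator.comp hl).sub (hl.comp hD.isLocalOperator)).sub
    ((hD.isLocalOperator.comp hf).sub (hf.comp hD.isLocalOperator))

theorem IsGerstenhaberGenerator.bracketDefect_ofFunction (hD : L.IsGerstenhaberGenerator D)
    (X : Cₛ^∞⟮𝓘(ℝ, E); F, A⟯) (f g : C^∞⟮𝓘(ℝ, E), M; 𝓘(ℝ, ℝ), ℝ⟯) :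
    L.bracketDefect D X f (ofFunction g) = 0 := by
  simp only [bracketDefect_apply, L.lieOperator_ofFunction, ← ofFunction_mul, hD.map_ofFunction,
    map_zero, mul_zero, sub_zero]

/-- Apply the recursion for `D` twice. What separates D² from commuting with left multiplication by
X is exactly the defect, which explains the form of `bracketDefect`. -/
theorem IsGerstenhaberGenerator.map_map_section_mul (hD : L.IsGerstenhaberGenerator D)
    (hdiv : ∀ X, D (ofSection X) = ofFunction (div X)) (X : Cₛ^∞⟮𝓘(ℝ, E); F, A⟯)
    (Q : Multisection E F A) :
    D (D (ofSection X * Q)) = ofSection X * D (D Q) - L.bracketDefect D X (div X) Q := by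
  rw [hD.map_section_mul X Q, map_sub, map_sub, hD.map_section_mul X (D Q), hdiv,
    bracketDefect_apply]
  abel

theorem IsGerstenhaberGenerator.bracketDefect_section_mul (hD : L.IsGerstenhaberGenerator D)
    (hdiv : ∀ X, D (ofSection X) = ofFunction (div X)) (X Y : Cₛ^∞⟮𝓘(ℝ, E); F, A⟯)
    (Q : Multisection E F A) :
    L.bracketDefect D X (div X) (ofSection Y * Q) =
      ofFunction (L.divergenceCurvature div X Y) * Q
        - ofSection Y * L.bracketDefect D X (div X) Q := by
  have h1 : ofFunction (div X) * (ofSection Y * Q) = ofSection Y * (ofFunction (div X) * Q) := by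
    rw [← mul_assoc, ofFunction_comm, mul_assoc]
  have h2 : ofFunction (div X) * (ofSection Y * D Q) = ofSection Y * (ofFunction (div X) * D Q) := by
    rw [← mul_assoc, ofFunction_comm, mul_assoc]
  have h3 : (ofFunction (div Y) * (ofFunction (div X) * Q) : Multisection E F A) =
      ofFunction (div X) * (ofFunction (div Y) * Q) := by
    rw [← mul_assoc, ← mul_assoc, ofFunction_comm]
  simp only [bracketDefect_apply, h1, hD.map_section_mul, hdiv, L.lieOperator_mul,
    L.lieOperator_ofFunction, L.lieOperator_ofSection, L.lieOperator_bracket, map_add, map_sub,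
    ofFunction_divergenceCurvature, add_mul, sub_mul, mul_sub, h2, h3]
  abel

theorem IsGerstenhaberGenerator.sq_eq_zero_iff (hD : L.IsGerstenhaberGenerator D)
    (hdiv : ∀ X, D (ofSection X) = ofFunction (div X)) :
    D ∘ₗ D = 0 ↔ ∀ X Y, L.divergenceCurvature div X Y = 0 := by
  have h0 : (ofFunction (0 : C^∞⟮𝓘(ℝ, E), M; 𝓘(ℝ, ℝ), ℝ⟯) : Multisection E F A) = 0 :=
    multisection_ext fun x => map_zero (algebraMap ℝ (ExteriorAlgebra ℝ (A x)))
  constructor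
  · intro h X Y
    have hsq : ∀ P, D (D P) = 0 := fun P => LinearMap.congr_fun h P
    have h1 := hD.map_map_section_mul hdiv X (ofSection Y)
    rw [hsq, hsq, mul_zero, zero_sub, eq_comm, neg_eq_zero] at h1
    have hone : (1 : Multisection E F A) = ofFunction (ContMDiffMap.const 1) :=
      multisection_ext fun x => (map_one (algebraMap ℝ (ExteriorAlgebra ℝ (A x)))).symm
    -- D² = 0 forces the defect of X to vanish on Y. Writing Y as Y∧1, where the defect kills 1,
    -- identifies this value with the curvature function.
    have h2 := hD.bracketDefect_section_mul hdiv X Y 1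
    rw [mul_one, mul_one, h1, hone, hD.bracketDefect_ofFunction, mul_zero, sub_zero] at h2
    exact ofFunction_injective (h2.symm.trans h0.symm)
  · intro h
    -- Locality is used twice: without curvature the defects anticommute with left multiplication by
    -- sections and so vanish, and then D² commutes with it and vanishes as well.
    have hN : ∀ X, L.bracketDefect D X (div X) = 0 := fun X => by
      refine (hD.isLocalOperator_bracketDefect X _).eq_zero
        (fun g => hD.bracketDefect_ofFunction X _ g) fun Y Q x hx => ?_
      rw [hD.bracketDefect_section_mul hdiv, h, h0, zero_mul, zero_sub]
      exact neg_eq_zero.2 ((congrArg ((ofSection Y : Multisection E F A).1 x * ·) hx).trans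
        (mul_zero _))
    refine (hD.isLocalOperator.comp hD.isLocalOperator).eq_zero (fun g => ?_) fun X Q x hx => ?_
    · rw [LinearMap.comp_apply, hD.map_ofFunction, map_zero]
    · rw [LinearMap.comp_apply, hD.map_map_section_mul hdiv, hN, LinearMap.zero_apply, sub_zero]
      exact (congrArg ((ofSection X : Multisection E F A).1 x * ·) hx).trans (mul_zero _)

theorem IsGerstenhaberGenerator.isFlat_connection_iff (hD : L.IsGerstenhaberGenerator D) :
    hD.connection.IsFlat ↔ L.IsBVGenerator D := by
  obtain ⟨div, hdiv⟩ := hD.exists_divergence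
  rw [hD.isFlat_iff hdiv, ← hD.sq_eq_zero_iff hdiv]
  exact ⟨fun h => ⟨hD, h⟩, fun h => h.2⟩

end LieAlgebroid

end Flatness

end AlgebroidBV

end

theorem mainTheorem1
    {E : Type*} [NormedAddCommGroup E] [NormedSpace ℝ E] [FiniteDimensional ℝ E]
    {M : Type*} [TopologicalSpace M] [ChartedSpace E M] [IsManifold 𝓘(ℝ, E) ∞ M]
    [T2Space M] [SigmaCompactSpace M]
    {F : Type*} [NormedAddCommGroup F] [NormedSpace ℝ F] [FiniteDimensional ℝ F]
    {A : M → Type*} [TopologicalSpace (TotalSpace F A)] [∀ x, TopologicalSpace (A x)]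
    [∀ x, AddCommGroup (A x)] [∀ x, Module ℝ (A x)] [FiberBundle F A] [VectorBundle ℝ F A]
    [ContMDiffVectorBundle ∞ F A 𝓘(ℝ, E)]
    (L : AlgebroidBV.LieAlgebroid E F A) (n : ℕ) (hn : Module.finrank ℝ F = n) :
    ∃ Φ : L.AConnection n ≃
        {D : AlgebroidBV.Multisection E F A →ₗ[ℝ] AlgebroidBV.Multisection E F A //
          L.IsGerstenhaberGenerator D},
      (∀ (C : L.AConnection n) (X : Cₛ^∞⟮𝓘(ℝ, E); F, A⟯)
        (Λ : AlgebroidBV.multisectionDeg E F A n) (x : M),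
        ((Φ C).1 (AlgebroidBV.ofSection X) * Λ.1).1 x =
          L.lieDeriv X Λ.1 x - (C.toFun X Λ).1.1 x) ∧
      (∀ (C : L.AConnection n) (X : Cₛ^∞⟮𝓘(ℝ, E); F, A⟯)
        (Λ : AlgebroidBV.multisectionDeg E F A n),
        (C.toFun X Λ).1 = -(AlgebroidBV.ofSection X * (Φ C).1 Λ.1)) ∧
      (∀ C : L.AConnection n, C.IsFlat ↔ L.IsBVGenerator (Φ C).1) := by
  subst hn
  -- The explicit direction sends a generator to ∇_XΛ = −X∧DΛ; the required bijection is its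
  -- inverse.
  let Ψ : {D : AlgebroidBV.Multisection E F A →ₗ[ℝ] AlgebroidBV.Multisection E F A //
      L.IsGerstenhaberGenerator D} ≃ L.AConnection (Module.finrank ℝ F) :=
    Equiv.ofBijective (fun D => D.2.connection)
      ⟨fun D D' h => Subtype.ext (D.2.eq_of_connection_eq D'.2 h), fun C => by
        obtain ⟨D, hD, h⟩ := C.exists_generator
        exact ⟨⟨D, hD⟩, h⟩⟩
  have hΨ : ∀ C, (Ψ.symm C).2.connection = C := fun C => Ψ.apply_symm_apply C
  have hformula : ∀ C X Λ, (C.toFun X Λ).1 =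
      -(AlgebroidBV.ofSection X * (Ψ.symm C).1 Λ.1) := fun C X Λ => by
    conv_lhs => rw [← hΨ C]
    rfl
  refine ⟨Ψ.symm, fun C X Λ x => ?_, hformula, fun C => ?_⟩
  · have h := hformula C X Λ
    rw [(Ψ.symm C).2.section_mul_map Λ.2] at h
    have h' : (Ψ.symm C).1 (AlgebroidBV.ofSection X) * Λ.1 =
        L.lieOperator X Λ.1 - (C.toFun X Λ).1 := by
      rw [h]
      abel
    exact congrFun (congrArg Subtype.val h') x
  · rw [← (Ψ.symm C).2.isFlat_connection_iff, hΨ]
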